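/- **Conventions.** Structures are relational, with non-empty domain. *Groups.* Let $\mathscr G$ be a permutation group on a non-empty set $A$. It is *oligomorphic* if for every $n\ge 1$ it has finitely many orbits on $A^n$, and *$2$-transitive* if any two pairs of distinct elements of $A$ lie in the same orbit. Its *canonical $k$-ary structure* is the structure on $A$ whose relations are exactly the orbits of $\mathscr G$ on $A^k$. *Bounds.* A structure $\mathbb B$ in a finite relational signature $\tau$ is *finitely bounded* if there is a finite set $\mathcal F$ of finite $\tau$-structures such that a finite $\tau$-structure embeds into $\mathbb B$ if and only if no member of $\mathcal F$ embeds into it. Then $b_{\mathbb B}$ denotes the least $b$ such that $\mathcal F$ can be chosen with all members of size at most $b$. *Expansions.* A *first-order expansion* of $\mathbb B$ is an expansion of $\mathbb B$ by relations that are first-order definable in $\mathbb B$ without parameters. A relation is *pp-definable* if it is definable by a formula built from atomic formulas (equalities included) by conjunction and existential quantification. *Instances.* An instance over a set $A$ consists of a finite set $V$ of variables and a finite set of constraints; a constraint is a set $C\subseteq A^U$, where $\emptyset\ne U\subseteq V$ is its scope. It is an instance of $\mathrm{CSP}(\mathbb A)$ if every constraint, for some enumeration of its scope without repetitions, becomes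 a relation of $\mathbb A$. It is *injective* if for every constraint $C$, every $f\in C$ and all distinct $x,y$ in the scope of $C$ we have $f(x)\neq f(y)$; the restriction of $\mathrm{CSP}(\mathbb A)$ to injective instances is $\mathrm{CSP}_{\mathrm{inj}}(\mathbb A)$. A *solution* is a map $f\colon V\to A$ with $f|_U\in C$ for every constraint $C$ with scope $U$. Two instances on the same variables are *equivalent* if they have the same solutions. An instance is *non-trivial* if no constraint is empty. It is *$(k,\ell)$-minimal* if the set of entries of every tuple of variables of length between $1$ and $\ell$ is contained in the scope of some constraint, and for every tuple of variables of length between $1$ and $k$, any two constraints whose scopes contain all its entries have the same projection onto it. *Width.* For a structure $\mathbb A$ and $\ell\ge 1$ let $\mathbb A'_\ell$ be the structure on the domain of $\mathbb A$ whose relations are all relations that are pp-definable in $\mathbb A$ and have arity at most the maximum of $\ell$ and the arities of the relations of $\mathbb A$. Let $1\le k\le \ell$. - $\mathbb A$ has *relational width $(k,\ell)$* if every non-trivial $(k,\ell)$-minimal instance of $\mathrm{CSP}(\mathbb A'_\ell)$ that is equivalent to an instance of $\mathrm{CSP}(\mathbb A)$ has a solution. - $\mathrm{CSP}_{\mathrm{inj}}(\mathbb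 A)$ has *relational width $(k,\ell)$* if every non-trivial $(k,\ell)$-minimal instance of $\mathrm{CSP}_{\mathrm{inj}}(\mathbb A'_\ell)$ that is equivalent to an instance of $\mathrm{CSP}_{\mathrm{inj}}(\mathbb A)$ has a solution. - $\mathbb A$ has *bounded strict width* if there are $m\ge 1$ and $\ell>m$ such that for every $(m,\ell)$-minimal instance of $\mathrm{CSP}(\mathbb A'_\ell)$ with variables $V$, and every $g\colon U\to A$ with $U\subseteq V$ such that each constraint of the instance contains a map that agrees with $g$ on the common part of their domains, some solution of the instance extends $g$. **Theorem.** Let $k\geq 2$, let $\mathscr G$ be a $2$-transitive oligomorphic permutation group, let $\mathbb B$ be its canonical $k$-ary structure, and suppose that $\mathbb B$ is finitely bounded. Let $\mathbb A$ be a first-order expansion of $\mathbb B$ that has bounded strict width. Then $\mathbb A$ has relational width $(k,\max(k+1,b_{\mathbb B}))$ if and only if $\mathrm{CSP}_{\mathrm{inj}}(\mathbb A)$ has relational width $(k,\max(k+1,b_{\mathbb B}))$. -/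

import Mathlib

universe u v w v' w'

namespace CSP

open scoped FirstOrder

/-! ### Permutation groups and canonical structures -/

/-- A permutation group on `A` is oligomorphic if it has finitely many orbits of `n`-tuples,
for every `n`. -/
def Oligomorphic {A : Type u} (G : Subgroup (Equiv.Perm A)) : Prop :=
  ∀ n : ℕ, Finite (MulAction.orbitRel.Quotient G (Fin n → A))

/-- The signature of the canonical `k`-ary structure of `G`: one `k`-ary relation symbol for every
orbit of `k`-tuples under `G`, and no other symbols. -/
def canonicalLanguage {A : Type u} (G : Subgroup (Equiv.Perm A)) (k : ℕ) : FirstOrder.Language.{0, u} where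
  Functions _ := Empty
  Relations n := {_O : MulAction.orbitRel.Quotient G (Fin n → A) // n = k}

/-- The canonical `k`-ary structure of `G`: every symbol is interpreted as its orbit. -/
instance canonicalStructure {A : Type u} (G : Subgroup (Equiv.Perm A)) (k : ℕ) :
    (canonicalLanguage G k).Structure A where
  funMap := fun f _ => nomatch f
  RelMap := fun O x => x ∈ O.1.orbit

/-! ### Finite boundedness -/

section Bounds

variable (L : FirstOrder.Language.{v, w})

/-- A finite `L`-structure, given up to isomorphism as a structure on `{0, …, n-1}`. -/
abbrev FinStructure := Σ n : ℕ, L.Structure (Fin n)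

variable {L}

/-- The finite structure `C` embeds into the structure `B`. -/
def FinStructure.EmbedsIn (C : FinStructure L) (B : Type u) [L.Structure B] : Prop :=
  letI := C.2
  Nonempty (Fin C.1 ↪[L] B)

/-- The finite structure `C` embeds into the finite structure `D`. -/
def FinStructure.EmbedsInFin (C D : FinStructure L) : Prop :=
  letI := D.2
  C.EmbedsIn (Fin D.1)

variable (L)

/-- `𝓕` is a set of bounds for `B`: a finite structure embeds into `B` if and only if no member of
`𝓕` embeds into it. -/
def IsBoundsFor (𝓕 : Set (FinStructure L)) (B : Type u) [L.Structure B] : Prop :=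
  ∀ C : FinStructure L, C.EmbedsIn B ↔ ∀ F ∈ 𝓕, ¬ F.EmbedsInFin C

/-- A structure in a finite relational signature is finitely bounded if it has a finite set of
bounds. -/
def FinitelyBounded (B : Type u) [L.Structure B] : Prop :=
  L.IsRelational ∧ Finite L.Symbols ∧
    ∃ 𝓕 : Set (FinStructure L), 𝓕.Finite ∧ IsBoundsFor L 𝓕 B

/-- The number `b_B`: the least `b` such that `B` has a finite set of bounds all of whose members
have at most `b` elements. -/
noncomputable def boundSize (B : Type u) [L.Structure B] : ℕ :=
  sInf {b : ℕ | ∃ 𝓕 : Set (FinStructure L), 𝓕.Finite ∧ IsBoundsFor L 𝓕 B ∧ ∀ F ∈ 𝓕, F.1 ≤ b}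

end Bounds

/-! ### First-order expansions and primitive positive definability -/

/-- The relational `L'`-structure on `A` is a first-order expansion of the `L`-structure on `A`:
it contains all relations of the latter, and all its relations are first-order definable (without
parameters) in the latter. -/
def IsFirstOrderExpansion (L : FirstOrder.Language.{v, w}) (L' : FirstOrder.Language.{v', w'}) (A : Type u)
    [L.Structure A] [L'.Structure A] : Prop :=
  L'.IsRelational ∧ (∃ φ : L →ᴸ L', φ.IsExpansionOn A) ∧
    ∀ (n : ℕ) (R : L'.Relations n),
      (∅ : Set A).Definable L {x : Fin n → A | FirstOrder.Language.Structure.RelMap R x}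

/-- Primitive positive formulas: built from atomic formulas (including equalities) by conjunction
and existential quantification. -/
inductive IsPrimitivePositive {L : FirstOrder.Language.{v, w}} {α : Type} :
    ∀ {n : ℕ}, L.BoundedFormula α n → Prop
  | of_isAtomic {n : ℕ} {φ : L.BoundedFormula α n} (h : φ.IsAtomic) : IsPrimitivePositive φ
  | inf {n : ℕ} {φ ψ : L.BoundedFormula α n} (h₁ : IsPrimitivePositive φ)
      (h₂ : IsPrimitivePositive ψ) : IsPrimitivePositive (φ ⊓ ψ)
  | ex {n : ℕ} {φ : L.BoundedFormula α (n + 1)} (h : IsPrimitivePositive φ) :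
      IsPrimitivePositive φ.ex

/-- The relation `R` is pp-definable in the `L`-structure `A`. -/
def PPDefinable (L : FirstOrder.Language.{v, w}) {A : Type u} [L.Structure A] {n : ℕ}
    (R : Set (Fin n → A)) : Prop :=
  ∃ φ : L.Formula (Fin n), IsPrimitivePositive φ ∧ ∀ x, x ∈ R ↔ φ.Realize x

/-- The signature of the structure `A'` on the domain of `A` whose relations are all relations
which are pp-definable in `A` and whose arity is at most the maximum of `ℓ` and of the arities of
the relations of `A`. -/
def ppLanguage (L : FirstOrder.Language.{v, w}) (A : Type u) [L.Structure A] (ℓ : ℕ) : FirstOrder.Language.{0, u} where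
  Functions _ := Empty
  Relations n := {R : Set (Fin n → A) //
    PPDefinable L R ∧ (n ≤ ℓ ∨ ∃ m, n ≤ m ∧ Nonempty (L.Relations m))}

/-- The expansion `A'` of `A` by pp-definable relations described at `ppLanguage`. -/
instance ppStructure (L : FirstOrder.Language.{v, w}) (A : Type u) [L.Structure A] (ℓ : ℕ) :
    (ppLanguage L A ℓ).Structure A where
  funMap := fun f _ => nomatch f
  RelMap := fun R x => x ∈ R.1

/-! ### Instances -/

/-- A constraint on variables from `V`: a non-empty scope `U ⊆ V`, and a subset of `A^U`. -/
structure Constraint (V : Type) (A : Type u) where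
  scope : Set V
  nonempty : scope.Nonempty
  rel : Set (scope → A)

/-- The projection of a constraint onto a tuple of variables from its scope. -/
def Constraint.proj {V : Type} {A : Type u} (C : Constraint V A) {m : ℕ} (t : Fin m → C.scope) :
    Set (Fin m → A) :=
  {a | ∃ f ∈ C.rel, a = f ∘ t}

/-- A finite set of constraints on the variables `V`. -/
structure Instance (V : Type) (A : Type u) where
  constraints : Set (Constraint V A)
  finite : constraints.Finite

section Instances

variable {V : Type} {A : Type u}

/-- The constraint `C` can be viewed as a relation of the `L`-structure `A` by enumerating its
scope without repetitions. -/
def Constraint.IsOf (L : FirstOrder.Language.{v, w}) [L.Structure A] (C : Constraint V A) : Prop :=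
  ∃ (n : ℕ) (e : Fin n ≃ C.scope) (R : L.Relations n),
    ∀ f : C.scope → A, f ∈ C.rel ↔ FirstOrder.Language.Structure.RelMap R (f ∘ e)

/-- `I` is an instance of `CSP(A)`, where `A` is an `L`-structure. -/
def Instance.IsOf (L : FirstOrder.Language.{v, w}) [L.Structure A] (I : Instance V A) : Prop :=
  ∀ C ∈ I.constraints, C.IsOf L

/-- The additional requirement on the instances of `CSP_inj`: for every constraint `C` and all
distinct variables `x`, `y` in its scope, the projection of `C` onto `(x, y)` contains only
injective pairs. -/
def Instance.IsInj (I : Instance V A) : Prop :=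
  ∀ C ∈ I.constraints, ∀ x y : C.scope, x ≠ y →
    C.proj ![x, y] ⊆ {a : Fin 2 → A | Function.Injective a}

/-- The assignment `f` is a solution of `I`. -/
def Instance.IsSolution (I : Instance V A) (f : V → A) : Prop :=
  ∀ C ∈ I.constraints, (fun x : C.scope => f x) ∈ C.rel

/-- Two instances are equivalent if they have the same solutions. -/
def Instance.Equivalent (I J : Instance V A) : Prop :=
  ∀ f : V → A, I.IsSolution f ↔ J.IsSolution f

/-- An instance is non-trivial if none of its constraints is empty. -/
def Instance.Nontrivial (I : Instance V A) : Prop :=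
  ∀ C ∈ I.constraints, C.rel.Nonempty

/-- `(k, ℓ)`-minimality. -/
def Instance.IsMinimal (I : Instance V A) (k ℓ : ℕ) : Prop :=
  (∀ m : ℕ, 1 ≤ m → m ≤ ℓ → ∀ t : Fin m → V,
    ∃ C ∈ I.constraints, Set.range t ⊆ C.scope) ∧
  (∀ m : ℕ, 1 ≤ m → m ≤ k → ∀ t : Fin m → V,
    ∀ C₁ ∈ I.constraints, ∀ C₂ ∈ I.constraints,
    ∀ (h₁ : ∀ i, t i ∈ C₁.scope) (h₂ : ∀ i, t i ∈ C₂.scope),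
      C₁.proj (fun i => ⟨t i, h₁ i⟩) = C₂.proj (fun i => ⟨t i, h₂ i⟩))

end Instances

/-! ### Relational width and strict width -/

section Width

variable (L : FirstOrder.Language.{v, w}) (A : Type u) [L.Structure A]

/-- `A` has relational width `(k, ℓ)`: every non-trivial `(k, ℓ)`-minimal instance (of the CSP of
the expansion `A'` of `A` by pp-definable relations) which is equivalent to an instance of `CSP(A)`
has a solution. -/
def HasRelationalWidth (k ℓ : ℕ) : Prop :=
  ∀ (V : Type) [Finite V] (J : Instance V A),
    J.IsOf (ppLanguage L A ℓ) → J.IsMinimal k ℓ → J.Nontrivial →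
    (∃ I : Instance V A, I.IsOf L ∧ J.Equivalent I) →
    ∃ f : V → A, J.IsSolution f

/-- `CSP_inj(A)` has relational width `(k, ℓ)`: the same requirement, restricted to injective
instances. -/
def InjHasRelationalWidth (k ℓ : ℕ) : Prop :=
  ∀ (V : Type) [Finite V] (J : Instance V A),
    J.IsOf (ppLanguage L A ℓ) → J.IsInj → J.IsMinimal k ℓ → J.Nontrivial →
    (∃ I : Instance V A, I.IsOf L ∧ I.IsInj ∧ J.Equivalent I) →
    ∃ f : V → A, J.IsSolution f

/-- `A` has strict width `k`: for some `ℓ > k`, in every `(k, ℓ)`-minimal instance (of the CSP of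
the expansion `A'` of `A` by pp-definable relations), every partial assignment which is consistent
with every single constraint extends to a solution. -/
def HasStrictWidth (k : ℕ) : Prop :=
  ∃ ℓ : ℕ, k < ℓ ∧ ∀ (V : Type) [Finite V] (J : Instance V A),
    J.IsOf (ppLanguage L A ℓ) → J.IsMinimal k ℓ →
    ∀ (U : Set V) (g : U → A),
      (∀ C ∈ J.constraints, ∃ f ∈ C.rel,
        ∀ (x : V) (hC : x ∈ C.scope) (hU : x ∈ U), f ⟨x, hC⟩ = g ⟨x, hU⟩) →
      ∃ f : V → A, J.IsSolution f ∧ ∀ x : U, f x = g x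

/-- `A` has bounded strict width if it has strict width `k` for some `k ≥ 1`. -/
def HasBoundedStrictWidth : Prop :=
  ∃ k : ℕ, 1 ≤ k ∧ HasStrictWidth L A k

end Width

end CSP

/-! Only the passage from injective to arbitrary instances has content. In a minimal instance,
identify the variables that are forced to be equal and keep only the injective maps in each
resulting constraint. Solutions of this contracted instance lift to the original one, so it must be
shown that contraction preserves non-triviality and minimality. Both hold because pp-definable
predicates do not acquire new equalities: restricting a subtuple to a compatible injective orbit
forces no further equality (`exists_orbit_and_ne`), and finitely many equalities that are not
implied can be violated simultaneously (`exists_forall_ne`).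

Strict width enters through `HasBoundedStrictWidth.exists_decomposition`: membership in a
pp-definable predicate is tested on boundedly many coordinates, with a bound depending only on the
arities of the atoms. Hence a ternary-like predicate `K` that is functional at one point but can be
switched to another value by changing its parameters is impossible (`not_isPP_of_chain`): in a long
chain of copies of `K` a single switch is invisible to every local test. All non-existence results
below reduce to this one.

If the contracted instance had no solution, any unsatisfiable injective instance would be equivalent
to it, and two distinct orbits of injective `k`-tuples provide one. If there is only one such orbit,
all permutations preserve the relations and every injective assignment is a solution. Domains with
at most two elements are treated directly. -/

namespace CSP

open FirstOrder FirstOrder.Language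

/-! ### Closure properties of pp-definable predicates, and a prenex form with bounded arity. -/

section PrimitivePositive

variable {L : FirstOrder.Language.{v, w}}

theorem IsPrimitivePositive.relabel {α β : Type} {n m : ℕ} {φ : L.BoundedFormula α m}
    (h : IsPrimitivePositive φ) (f : α → β ⊕ Fin n) : IsPrimitivePositive (φ.relabel f) := by
  induction h with
  | of_isAtomic h => exact .of_isAtomic (h.relabel f)
  | inf _ _ h₁ h₂ => exact .inf h₁ h₂
  | ex _ h => rw [BoundedFormula.relabel_ex]; exact .ex h

theorem IsPrimitivePositive.exs {α : Type} {n : ℕ} {φ : L.BoundedFormula α n}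
    (h : IsPrimitivePositive φ) : IsPrimitivePositive φ.exs := by
  induction n with
  | zero => exact h
  | succ n ih => exact ih (.ex h)

variable {A : Type u} [L.Structure A]

/-- The predicate `P` is defined by a primitive positive formula with free variables in `ι`. -/
def IsPP (L : FirstOrder.Language.{v, w}) {A : Type u} [L.Structure A] {ι : Type}
    (P : (ι → A) → Prop) : Prop :=
  ∃ φ : L.Formula ι, IsPrimitivePositive φ ∧ ∀ x, P x ↔ φ.Realize x

namespace IsPP

variable {ι κ : Type}

theorem and {P Q : (ι → A) → Prop} (hP : IsPP L P) (hQ : IsPP L Q) :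
    IsPP L fun x => P x ∧ Q x := by
  obtain ⟨φ, hφ, h⟩ := hP
  obtain ⟨ψ, hψ, h'⟩ := hQ
  exact ⟨φ ⊓ ψ, .inf hφ hψ, fun x => by
    rw [Formula.realize_inf]; exact and_congr (h x) (h' x)⟩

theorem comp {P : (ι → A) → Prop} (hP : IsPP L P) (f : ι → κ) :
    IsPP L fun x : κ → A => P (x ∘ f) := by
  obtain ⟨φ, hφ, h⟩ := hP
  exact ⟨φ.relabel f, hφ.relabel _, fun x => by
    rw [Formula.realize_relabel]; exact h _⟩

theorem ex [Finite κ] {P : (ι ⊕ κ → A) → Prop} (hP : IsPP L P) :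
    IsPP L fun x : ι → A => ∃ z : κ → A, P (Sum.elim x z) := by
  obtain ⟨φ, hφ, h⟩ := hP
  refine ⟨φ.iExs κ, (hφ.relabel _).exs, fun x => ?_⟩
  rw [Formula.realize_iExs]
  simp only [h]

theorem eq (i j : ι) : IsPP L fun x : ι → A => x i = x j :=
  ⟨Term.equal (Term.var i) (Term.var j), .of_isAtomic (.equal _ _), fun x => by
    rw [Formula.realize_equal]; rfl⟩

theorem relMap {n : ℕ} (R : L.Relations n) : IsPP L fun x : Fin n → A => Structure.RelMap R x :=
  ⟨R.formula fun i => Term.var i, .of_isAtomic (.rel _ _), fun x => by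
    rw [Formula.realize_rel]; rfl⟩

theorem true [Nonempty A] : IsPP L fun _ : ι → A => True := by
  -- Since `ι` may be empty, the tautology `z = z` needs a quantified variable, hence a point of
  -- `A`.
  have h : IsPP L fun x : ι → A => ∃ z : Unit → A,
      Sum.elim x z (Sum.inr ()) = Sum.elim x z (Sum.inr ()) :=
    (IsPP.eq (L := L) (A := A) (Sum.inr () : ι ⊕ Unit) (Sum.inr ())).ex
  simpa using h

theorem all [Nonempty A] {β : Type*} [Finite β] {P : β → (ι → A) → Prop}
    (hP : ∀ b, IsPP L (P b)) : IsPP L fun x => ∀ b, P b x := by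
  have key : ∀ s : Finset β, IsPP L fun x => ∀ b ∈ s, P b x := by
    classical
    intro s
    induction s using Finset.induction_on with
    | empty => simpa using IsPP.true (L := L) (A := A) (ι := ι)
    | insert b s _ ih => simpa using (hP b).and ih
  have := Fintype.ofFinite β
  simpa using key Finset.univ

theorem congr {P Q : (ι → A) → Prop} (hP : IsPP L P) (h : ∀ x, Q x ↔ P x) : IsPP L Q := by
  rwa [show Q = P from funext fun x => propext (h x)]

end IsPP

/-- Relations that interpret a relation symbol, and the equality relation. -/
def IsBasic (L : FirstOrder.Language.{v, w}) {A : Type u} [L.Structure A] {n : ℕ}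
    (S : Set (Fin n → A)) : Prop :=
  (∃ R : L.Relations n, S = {x | Structure.RelMap R x}) ∨ (n = 2 ∧ ∃ i j, S = {x | x i = x j})

theorem IsBasic.isPP {n : ℕ} {S : Set (Fin n → A)} (h : IsBasic L S) : IsPP L (· ∈ S) := by
  obtain ⟨R, rfl⟩ | ⟨-, i, j, rfl⟩ := h
  · exact IsPP.relMap R
  · exact IsPP.eq i j

/-- The predicate `P` is defined by an existentially quantified finite conjunction of equalities
and of atomic formulas whose arity is at most `r + 2`. -/
def IsBoundedPP (L : FirstOrder.Language.{v, w}) {A : Type u} [L.Structure A] (r : ℕ) {ι : Type}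
    (P : (ι → A) → Prop) : Prop :=
  ∃ (W B : Type) (_ : Finite W) (_ : Finite B) (n : B → ℕ) (S : ∀ b, Set (Fin (n b) → A))
    (s : ∀ b, Fin (n b) → ι ⊕ W), (∀ b, IsBasic L (S b) ∧ n b ≤ r + 2) ∧
      ∀ x, P x ↔ ∃ z : W → A, ∀ b, Sum.elim x z ∘ s b ∈ S b

namespace IsBoundedPP

variable {ι κ : Type} {r : ℕ}

theorem mono {r' : ℕ} (hr : r ≤ r') {P : (ι → A) → Prop} (hP : IsBoundedPP L r P) :
    IsBoundedPP L r' P := by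
  obtain ⟨W, B, hW, hB, n, S, s, h, h'⟩ := hP
  exact ⟨W, B, hW, hB, n, S, s, fun b => ⟨(h b).1, (h b).2.trans (by omega)⟩, h'⟩

theorem congr {P Q : (ι → A) → Prop} (hP : IsBoundedPP L r P) (h : ∀ x, Q x ↔ P x) :
    IsBoundedPP L r Q := by
  rwa [show Q = P from funext fun x => propext (h x)]

theorem and {P Q : (ι → A) → Prop} (hP : IsBoundedPP L r P) (hQ : IsBoundedPP L r Q) :
    IsBoundedPP L r fun x => P x ∧ Q x := by
  obtain ⟨W, B, hW, hB, n, S, s, h, h'⟩ := hP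
  obtain ⟨W₁, B₁, hW₁, hB₁, n₁, S₁, s₁, h₁, h₁'⟩ := hQ
  refine ⟨W ⊕ W₁, B ⊕ B₁, inferInstance, inferInstance, Sum.elim n n₁,
    fun b => Sum.casesOn b S S₁,
    fun b => Sum.casesOn b (fun b i => Sum.map id Sum.inl (s b i))
      (fun b i => Sum.map id Sum.inr (s₁ b i)), ?_, fun x => ?_⟩
  · rintro (b | b)
    · exact h b
    · exact h₁ b
  · have e₁ : ∀ (z : W ⊕ W₁ → A) b, (fun i => Sum.elim x z (Sum.map id Sum.inl (s b i)))
        = Sum.elim x (z ∘ Sum.inl) ∘ s b := by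
      intro z b; funext i; rcases hi : s b i with j | j <;> simp [hi]
    have e₂ : ∀ (z : W ⊕ W₁ → A) b, (fun i => Sum.elim x z (Sum.map id Sum.inr (s₁ b i)))
        = Sum.elim x (z ∘ Sum.inr) ∘ s₁ b := by
      intro z b; funext i; rcases hi : s₁ b i with j | j <;> simp [hi]
    refine (and_congr (h' x) (h₁' x)).trans ?_
    constructor
    · rintro ⟨⟨z, hz⟩, z₁, hz₁⟩
      refine ⟨Sum.elim z z₁, ?_⟩
      rintro (b | b)
      · change (fun i => Sum.elim x _ (Sum.map id Sum.inl (s b i))) ∈ S b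
        rw [e₁]; exact hz b
      · change (fun i => Sum.elim x _ (Sum.map id Sum.inr (s₁ b i))) ∈ S₁ b
        rw [e₂]; exact hz₁ b
    · rintro ⟨z, hz⟩
      refine ⟨⟨z ∘ Sum.inl, fun b => ?_⟩, z ∘ Sum.inr, fun b => ?_⟩
      · rw [← e₁]; exact hz (Sum.inl b)
      · rw [← e₂]; exact hz (Sum.inr b)

theorem comp {P : (ι → A) → Prop} (hP : IsBoundedPP L r P) (f : ι → κ) :
    IsBoundedPP L r fun x : κ → A => P (x ∘ f) := by
  obtain ⟨W, B, hW, hB, n, S, s, h, h'⟩ := hP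
  refine ⟨W, B, hW, hB, n, S, fun b => Sum.map f id ∘ s b, h, fun x => ?_⟩
  refine (h' _).trans ?_
  simp only [← Function.comp_assoc, Sum.elim_comp_map, Function.comp_id]

theorem ex [hκ : Finite κ] {P : (ι ⊕ κ → A) → Prop} (hP : IsBoundedPP L r P) :
    IsBoundedPP L r fun x : ι → A => ∃ z : κ → A, P (Sum.elim x z) := by
  obtain ⟨W, B, hW, hB, n, S, s, h, h'⟩ := hP
  refine ⟨κ ⊕ W, B, inferInstance, hB, n, S, fun b => Equiv.sumAssoc ι κ W ∘ s b, h,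
    fun x => ?_⟩
  have e : ∀ (z : κ → A) (t : W → A), Sum.elim x (Sum.elim z t) ∘ Equiv.sumAssoc ι κ W =
      Sum.elim (Sum.elim x z) t := by
    intro z t; funext i; rcases i with (i | i) | i <;> rfl
  simp only [h', ← Function.comp_assoc]
  constructor
  · rintro ⟨z, t, hzt⟩
    exact ⟨Sum.elim z t, fun b => by rw [e]; exact hzt b⟩
  · rintro ⟨z, hz⟩
    refine ⟨z ∘ Sum.inl, z ∘ Sum.inr, fun b => ?_⟩
    rw [← e, Sum.elim_comp_inl_inr]; exact hz b

theorem of_isBasic {n : ℕ} {S : Set (Fin n → A)} (hS : IsBasic L S) (hn : n ≤ r + 2)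
    (t : Fin n → ι) : IsBoundedPP L r fun x => x ∘ t ∈ S :=
  ⟨Empty, Unit, inferInstance, inferInstance, fun _ => n, fun _ => S, fun _ => Sum.inl ∘ t,
    fun _ => ⟨hS, hn⟩, fun x => by simp [← Function.comp_assoc]⟩

theorem eq (i j : ι) : IsBoundedPP L r fun x : ι → A => x i = x j := by
  have := of_isBasic (L := L) (r := r) (S := {x : Fin 2 → A | x 0 = x 1}) (.inr ⟨rfl, 0, 1, rfl⟩)
    (by omega) ![i, j]
  simpa using this

theorem true : IsBoundedPP L r fun _ : ι → A => True :=
  ⟨Empty, Empty, inferInstance, inferInstance, fun _ => 0, nofun, nofun, nofun, by simp⟩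

theorem all {β : Type*} [Finite β] {P : β → (ι → A) → Prop}
    (hP : ∀ b, IsBoundedPP L r (P b)) : IsBoundedPP L r fun x => ∀ b, P b x := by
  have key : ∀ s : Finset β, IsBoundedPP L r fun x => ∀ b ∈ s, P b x := by
    classical
    intro s
    induction s using Finset.induction_on with
    | empty => simpa using IsBoundedPP.true (L := L) (A := A) (ι := ι)
    | insert b s _ ih => simpa using (hP b).and ih
  have := Fintype.ofFinite β
  simpa using key Finset.univ

end IsBoundedPP

theorem exists_isBoundedPP_realize [L.IsRelational] {ι : Type} {n : ℕ} {φ : L.BoundedFormula ι n}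
    (h : IsPrimitivePositive φ) :
    ∃ r, IsBoundedPP L r fun x : ι ⊕ Fin n → A => φ.Realize (x ∘ Sum.inl) (x ∘ Sum.inr) := by
  have term : ∀ {n : ℕ} (t : L.Term (ι ⊕ Fin n)), ∃ i, t = Term.var i := by
    rintro n (i | ⟨f, _⟩)
    · exact ⟨i, rfl⟩
    · exact isEmptyElim f
  induction h with
  | of_isAtomic h =>
    obtain ⟨t₁, t₂⟩ | ⟨R, ts⟩ := h
    · obtain ⟨i, rfl⟩ := term t₁
      obtain ⟨j, rfl⟩ := term t₂
      refine ⟨0, (IsBoundedPP.eq i j).congr fun x => ?_⟩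
      rw [BoundedFormula.realize_bdEqual]
      simp
    · choose t ht using fun i => term (ts i)
      refine ⟨_, (IsBoundedPP.of_isBasic (.inl ⟨R, rfl⟩) (Nat.le_add_right _ 2) t).congr
        fun x => ?_⟩
      rw [BoundedFormula.realize_rel]
      refine iff_of_eq (congrArg _ (funext fun i => ?_))
      rw [ht, Function.comp_apply]
      rcases t i with j | j <;> rfl
  | inf _ _ h₁ h₂ =>
    obtain ⟨r₁, h₁⟩ := h₁
    obtain ⟨r₂, h₂⟩ := h₂
    exact ⟨max r₁ r₂, ((h₁.mono (le_max_left _ _)).and (h₂.mono (le_max_right _ _))).congr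
      fun x => BoundedFormula.realize_inf⟩
  | @ex n φ _ h =>
    obtain ⟨r, h⟩ := h
    let f : ι ⊕ Fin (n + 1) → (ι ⊕ Fin n) ⊕ Unit :=
      Sum.elim (Sum.inl ∘ Sum.inl) (Fin.snoc (Sum.inl ∘ Sum.inr) (Sum.inr ()))
    refine ⟨r, ((h.comp f).ex).congr fun x => ?_⟩
    rw [BoundedFormula.realize_ex]
    have e : ∀ z : Unit → A, (Sum.elim x z ∘ f) ∘ Sum.inr = Fin.snoc (x ∘ Sum.inr) (z ()) := by
      intro z
      funext i
      refine Fin.lastCases ?_ (fun i => ?_) i <;> simp [f]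
    constructor
    · rintro ⟨a, ha⟩
      exact ⟨fun _ => a, by rw [e]; exact ha⟩
    · rintro ⟨z, hz⟩
      exact ⟨z (), by rw [e] at hz; exact hz⟩

theorem IsPP.exists_isBoundedPP [L.IsRelational] {ι : Type} {P : (ι → A) → Prop}
    (hP : IsPP L P) : ∃ r, IsBoundedPP L r P := by
  obtain ⟨φ, hφ, h⟩ := hP
  obtain ⟨r, hr⟩ := exists_isBoundedPP_realize (A := A) hφ
  refine ⟨r, (hr.comp (Sum.elim id Fin.elim0)).congr fun x => ?_⟩
  rw [h, Formula.Realize]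
  exact iff_of_eq (congrArg₂ _ rfl (Subsingleton.elim _ _))

end PrimitivePositive

/-! ### Invariance under the group, and pp-definability of short orbits. -/

section Invariance

variable {A : Type u} {G : Subgroup (Equiv.Perm A)} {k : ℕ} {L : FirstOrder.Language.{v, w}}
  [L.Structure A]

/-- The permutation need not lie in `G`: agreeing with members of `G` on each `k`-tuple makes it an
automorphism of the canonical structure. This generality serves the `k`-transitive case, where every
permutation qualifies. -/
theorem IsFirstOrderExpansion.map_relMap_iff
    (hA : IsFirstOrderExpansion (canonicalLanguage G k) L A) {σ : Equiv.Perm A}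
    (hσ : ∀ x : Fin k → A, ∃ g ∈ G, ∀ i, g (x i) = σ (x i)) {n : ℕ} (R : L.Relations n)
    (x : Fin n → A) : Structure.RelMap R (σ ∘ x) ↔ Structure.RelMap R x := by
  obtain ⟨φ, hφ⟩ := Set.empty_definable_iff.1 (hA.2.2 n R)
  let e : A ≃[canonicalLanguage G k] A :=
    { σ with
      map_fun' := fun f => nomatch f
      map_rel' := by
        rintro _ ⟨O, rfl⟩ y
        obtain ⟨g, hg, h⟩ := hσ y
        have : (⇑σ ∘ y) = (⟨g, hg⟩ : G) • y := by
          funext i; exact (h i).symm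
        change (⇑σ ∘ y) ∈ O.orbit ↔ y ∈ O.orbit
        rw [this, MulAction.orbitRel.Quotient.mem_orbit, MulAction.orbitRel.Quotient.mem_orbit,
          show (Quotient.mk'' ((⟨g, hg⟩ : G) • y) : MulAction.orbitRel.Quotient G (Fin _ → A)) =
            Quotient.mk'' y from Quotient.sound' (MulAction.mem_orbit _ _)] }
  have h : ∀ y : Fin n → A, Structure.RelMap R y ↔ φ.Realize y := fun y =>
    Set.ext_iff.1 hφ y
  rw [h, h]
  exact StrongHomClass.realize_formula e φ

theorem IsPP.map_iff (hA : IsFirstOrderExpansion (canonicalLanguage G k) L A) {σ : Equiv.Perm A}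
    (hσ : ∀ x : Fin k → A, ∃ g ∈ G, ∀ i, g (x i) = σ (x i)) {ι : Type} {P : (ι → A) → Prop}
    (hP : IsPP L P) (x : ι → A) : P (σ ∘ x) ↔ P x := by
  obtain ⟨φ, -, h⟩ := hP
  have := hA.1
  let e : A ≃[L] A :=
    { σ with
      map_fun' := fun f => isEmptyElim f
      map_rel' := fun R y => hA.map_relMap_iff hσ R y }
  rw [h, h]
  exact StrongHomClass.realize_formula e φ

theorem IsPP.smul_iff (hA : IsFirstOrderExpansion (canonicalLanguage G k) L A)
    {g : Equiv.Perm A} (hg : g ∈ G) {ι : Type} {P : (ι → A) → Prop}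
    (hP : IsPP L P) (x : ι → A) : P (g ∘ x) ↔ P x :=
  hP.map_iff hA (fun _ => ⟨g, hg, fun _ => rfl⟩) x

/-- Orbits of tuples whose length is at most `k` are pp-definable. -/
theorem isPP_orbit (hA : IsFirstOrderExpansion (canonicalLanguage G k) L A) {ι : Type} [Finite ι]
    [Nonempty ι] (hι : Nat.card ι ≤ k) (a : ι → A) :
    IsPP L fun x : ι → A => ∃ g ∈ G, x = g ∘ a := by
  obtain ⟨φ, hφ⟩ := hA.2.1
  have := Fintype.ofFinite ι
  -- The orbit symbols have arity exactly `k`, so shorter tuples are padded by repeating entries.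
  obtain ⟨f, hf⟩ : ∃ f : Fin k → ι, f.Surjective := by
    rw [Nat.card_eq_fintype_card] at hι
    have h : Nonempty (ι ↪ Fin k) := Function.Embedding.nonempty_of_card_le (by simpa using hι)
    exact ⟨_, Function.invFun_surjective h.some.injective⟩
  let O : (canonicalLanguage G k).Relations k := ⟨Quotient.mk'' (a ∘ f), rfl⟩
  refine ((IsPP.relMap (φ.onRelation O)).comp f).congr fun x => ?_
  rw [LHom.map_onRelation]
  change _ ↔ x ∘ f ∈ O.1.orbit
  rw [MulAction.orbitRel.Quotient.mem_orbit]
  constructor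
  · rintro ⟨g, hg, rfl⟩
    exact Quotient.sound' ⟨⟨g, hg⟩, rfl⟩
  · intro h
    obtain ⟨g, hg⟩ := Quotient.exact' h
    refine ⟨g, g.2, funext fun i => ?_⟩
    obtain ⟨j, rfl⟩ := hf i
    exact (congrFun hg j).symm

theorem smul_orbit_iff {κ : Type} {h : Equiv.Perm A} (hh : h ∈ G) {a t : κ → A} :
    (∃ g ∈ G, h ∘ t = g ∘ a) ↔ ∃ g ∈ G, t = g ∘ a := by
  constructor
  · rintro ⟨g, hg, e⟩
    refine ⟨h⁻¹ * g, G.mul_mem (G.inv_mem hh) hg, ?_⟩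
    rw [Equiv.Perm.coe_mul, Function.comp_assoc, ← e, ← Function.comp_assoc, ← Equiv.Perm.coe_mul,
      inv_mul_cancel, Equiv.Perm.coe_one, Function.id_comp]
  · rintro ⟨g, hg, rfl⟩
    exact ⟨h * g, G.mul_mem hh hg, rfl⟩

end Invariance

/-! ### Strict width gives decomposition into boundedly many coordinates. -/

section Decomposition

variable {L : FirstOrder.Language.{v, w}} {A : Type u} [L.Structure A]

theorem IsPP.image [Nonempty A] {ι κ : Type} [Finite ι] [Finite κ] {P : (ι → A) → Prop}
    (hP : IsPP L P) (f : κ → ι) :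
    IsPP L fun x : κ → A => ∃ y : ι → A, P y ∧ ∀ i, y (f i) = x i := by
  refine IsPP.ex (P := fun z : κ ⊕ ι → A => P (z ∘ Sum.inr) ∧
    ∀ i, z (Sum.inr (f i)) = z (Sum.inl i)) ?_
  exact (hP.comp _).and (.all fun i => .eq _ _)

theorem Constraint.isOf_ppLanguage_iff {V : Type} [Finite V] {C : Constraint V A} {ℓ : ℕ} :
    C.IsOf (ppLanguage L A ℓ) ↔ IsPP L (· ∈ C.rel) ∧
      (Nat.card C.scope ≤ ℓ ∨ ∃ m, Nat.card C.scope ≤ m ∧ Nonempty (L.Relations m)) := by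
  constructor
  · rintro ⟨n, e, ⟨R, hR, hn⟩, h⟩
    have hn' : Nat.card C.scope = n := by rw [← Nat.card_congr e, Nat.card_fin]
    refine ⟨?_, by rwa [hn']⟩
    exact (IsPP.comp (P := (· ∈ R)) hR e).congr h
  · rintro ⟨hP, hn⟩
    let e := Finite.equivFin C.scope
    refine ⟨_, e.symm, ⟨{x | x ∘ e ∈ C.rel}, hP.comp e, hn⟩, fun f => ?_⟩
    change _ ↔ (f ∘ e.symm) ∘ e ∈ C.rel
    rw [Function.comp_assoc, e.symm_comp_self, Function.comp_id]

/-- The projection of the solutions of `P` to the set `U` of variables, as a constraint. -/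
def projConstraint {V : Type} (P : (V → A) → Prop) (U : {U : Set V // U.Nonempty}) :
    Constraint V A where
  scope := U.1
  nonempty := U.2
  rel := {f | ∃ y, P y ∧ ∀ i : U.1, y i = f i}

theorem proj_projConstraint {V : Type} (P : (V → A) → Prop) (U : {U : Set V // U.Nonempty}) {m : ℕ}
    (t : Fin m → U.1) :
    (projConstraint P U).proj t = {a | ∃ y, P y ∧ ∀ i, a i = y (t i)} := by
  ext a
  constructor
  · rintro ⟨f, ⟨y, hy, h⟩, rfl⟩
    exact ⟨y, hy, fun i => (h _).symm⟩
  · rintro ⟨y, hy, h⟩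
    exact ⟨fun i => y i, ⟨y, hy, fun _ => rfl⟩, funext h⟩

/-- A structure with bounded strict width decomposes pp-definable predicates: a tuple satisfies such
a predicate as soon as all its restrictions to few coordinates can be extended to tuples which
satisfy it. -/
theorem HasBoundedStrictWidth.exists_decomposition [Nonempty A] (hsw : HasBoundedStrictWidth L A)
    (r : ℕ) : ∃ N : ℕ, ∀ {ι : Type} [Finite ι] {P : (ι → A) → Prop}, IsBoundedPP L r P →
      ∀ g : ι → A, (∀ S : Set ι, S.ncard ≤ N → ∃ x, P x ∧ ∀ i ∈ S, x i = g i) → P g := by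
  obtain ⟨m, hm, ℓ, hℓ, H⟩ := hsw
  -- This bounds the scopes of `J` below: at most `ℓ`, or those of an atom, at most `r + 2`. Neither
  -- the number of variables nor that of atoms matters.
  refine ⟨ℓ + (r + 2), ?_⟩
  rintro ι hι P ⟨W, B, hW, hB, n, S, s, hS, h⟩ g hg
  let Q : (ι ⊕ W → A) → Prop := fun y => ∀ b, y ∘ s b ∈ S b
  have hQ : IsPP L Q := .all fun b => (hS b).1.isPP.comp _
  -- Quantified variables become variables of the instance. All constraints are projections of one
  -- solution set, so minimality is automatic.
  let J : Instance (ι ⊕ W) A :=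
    { constraints := projConstraint Q ''
        {U | U.1.ncard ≤ ℓ ∨ ∃ b, U.1 = Set.range (s b)}
      finite := (Set.toFinite _).image _ }
  have hrange : ∀ b, (Set.range (s b)).ncard ≤ n b := fun b => by
    rw [← Set.image_univ]
    exact (Set.ncard_image_le Set.finite_univ).trans (by simp [Set.ncard_univ])
  have hJ : J.IsOf (ppLanguage L A ℓ) := by
    rintro _ ⟨U, hU, rfl⟩
    rw [Constraint.isOf_ppLanguage_iff]
    refine ⟨hQ.image (fun i : U.1 => (i : ι ⊕ W)), ?_⟩
    change U.1.ncard ≤ ℓ ∨ ∃ m, U.1.ncard ≤ m ∧ _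
    obtain hU | ⟨b, hU⟩ := hU
    · exact .inl hU
    · have hb := hrange b
      rw [← hU] at hb
      obtain ⟨R, -⟩ | ⟨h2, -⟩ := (hS b).1
      · exact .inr ⟨_, hb, ⟨R⟩⟩
      · exact .inl (by omega)
  have hmin : J.IsMinimal m ℓ := by
    constructor
    · intro m' h1 h2 t
      refine ⟨_, ⟨⟨Set.range t, ⟨t ⟨0, h1⟩, ⟨0, h1⟩, rfl⟩⟩, .inl ?_, rfl⟩, subset_rfl⟩
      change (Set.range t).ncard ≤ ℓ
      rw [← Set.image_univ]
      exact (Set.ncard_image_le Set.finite_univ).trans (by simpa [Set.ncard_univ])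
    · rintro m' - - t _ ⟨U₁, -, rfl⟩ _ ⟨U₂, -, rfl⟩ h₁ h₂
      exact (proj_projConstraint Q U₁ fun i => ⟨t i, h₁ i⟩).trans
        (proj_projConstraint Q U₂ fun i => ⟨t i, h₂ i⟩).symm
  obtain ⟨f, hf, hfg⟩ := H (ι ⊕ W) J hJ hmin (Set.range Sum.inl)
    (fun i => Sum.elim g (fun _ => Classical.arbitrary A) (i : ι ⊕ W)) (by
      rintro _ ⟨U, hU, rfl⟩
      have hU' : U.1.ncard ≤ ℓ + (r + 2) := by
        obtain hU | ⟨b, hU⟩ := hU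
        · omega
        · rw [hU]; have := hrange b; have := (hS b).2; omega
      obtain ⟨x, hx, hxg⟩ := hg (Sum.inl ⁻¹' U.1) (by
        rw [← Set.ncard_image_of_injective _ Sum.inl_injective]
        exact (Set.ncard_le_ncard (Set.image_preimage_subset _ _)).trans hU')
      obtain ⟨z, hz⟩ := (h x).1 hx
      refine ⟨fun i => Sum.elim x z i, ⟨_, hz, fun _ => rfl⟩, ?_⟩
      rintro _ hC ⟨i, rfl⟩
      exact hxg i hC)
  refine (h g).2 ⟨f ∘ Sum.inr, fun b => ?_⟩
  have e : Sum.elim g (f ∘ Sum.inr) = f := by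
    rw [← Sum.elim_comp_inl_inr f]
    congr 1
    funext i
    exact (hfg ⟨Sum.inl i, i, rfl⟩).symm
  rw [e]
  -- A nullary atom has empty scope and yields no constraint; it holds because `P` is satisfiable,
  -- which is the hypothesis for the empty set.
  rcases Nat.eq_zero_or_pos (n b) with hb | hb
  · obtain ⟨x, hx, -⟩ := hg ∅ (by simp)
    obtain ⟨z, hz⟩ := (h x).1 hx
    convert hz b using 1
    funext i
    exact absurd i.2 (by omega)
  · obtain ⟨y, hy, hyf⟩ := hf _ ⟨⟨Set.range (s b), ⟨s b ⟨0, hb⟩, ⟨0, hb⟩, rfl⟩⟩, .inr ⟨b, rfl⟩, rfl⟩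
    convert hy b using 1
    funext i
    exact (hyf ⟨s b i, i, rfl⟩).symm

end Decomposition

/-! ### The chain argument. -/

section Chain

variable {A : Type u} [Nonempty A] {G : Subgroup (Equiv.Perm A)} {k : ℕ}
  {L : FirstOrder.Language.{v, w}} [L.Structure A]

/-- A predicate `K` with the properties below is not pp-definable: composing the relations
`K y · ·` along a long path of translates of `y` by powers of `g` would yield pp-definable
predicates which cannot be decomposed. -/
theorem not_isPP_of_chain (hA : IsFirstOrderExpansion (canonicalLanguage G k) L A)
    (hsw : HasBoundedStrictWidth L A) {Z : Type} [Finite Z] {K : (Z → A) → A → A → Prop}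
    {g : Equiv.Perm A} (hg : g ∈ G) {y s : Z → A} {a b : A} (hab : a ≠ b)
    (ha : K y a (g a)) (hb : K y b (g b)) (hs : K s a (g b)) (hfun : ∀ c, K y a c → c = g a) :
    ¬ IsPP L fun x : Z ⊕ Bool → A => K (x ∘ Sum.inl) (x (Sum.inr false)) (x (Sum.inr true)) := by
  intro hK
  have := hA.1
  have hinv : ∀ h ∈ G, ∀ y a c, K (h ∘ y) (h a) (h c) ↔ K y a c := by
    intro h hh y a c
    exact hK.smul_iff hA hh (Sum.elim y fun i => if i then c else a)
  obtain ⟨r, hr⟩ := hK.exists_isBoundedPP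
  obtain ⟨N, hN⟩ := hsw.exists_decomposition r
  -- One more link than coordinates tested, so some link has all its parameters untested.
  let n := N + 1
  let Q : ((Fin n × Z) ⊕ Bool → A) → Prop := fun x => ∃ c : Fin (n + 1) → A,
    (c 0 = x (Sum.inr false) ∧ c (Fin.last n) = x (Sum.inr true)) ∧
      ∀ i : Fin n, K (fun z => x (Sum.inl (i, z))) (c i.castSucc) (c i.succ)
  -- A longer path adds atoms but does not raise their arity, so `r` and `N` do not depend on `n`.
  have hQ : IsBoundedPP L r Q := by
    refine IsBoundedPP.ex (P := fun x : ((Fin n × Z) ⊕ Bool) ⊕ Fin (n + 1) → A =>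
      (x (Sum.inr 0) = x (Sum.inl (Sum.inr false)) ∧
        x (Sum.inr (Fin.last n)) = x (Sum.inl (Sum.inr true))) ∧
      ∀ i : Fin n, K (fun z => x (Sum.inl (Sum.inl (i, z)))) (x (Sum.inr i.castSucc))
        (x (Sum.inr i.succ))) ?_
    refine ((IsBoundedPP.eq _ _).and (.eq _ _)).and (.all fun i => ?_)
    exact hr.comp (Sum.elim (fun z => Sum.inl (Sum.inl (i, z)))
      fun j => if j then Sum.inr i.succ else Sum.inr i.castSucc)
  let t : (Fin n × Z) ⊕ Bool → A := Sum.elim (fun p => (g ^ (p.1 : ℕ)) (y p.2))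
    fun j => if j then (g ^ n) b else a
  obtain ⟨c, ⟨hc0, hcn⟩, hc⟩ : Q t := by
    refine hN hQ t fun S hS => ?_
    obtain ⟨i₀, hi₀⟩ : ∃ i₀ : Fin n, ∀ z, Sum.inl (i₀, z) ∉ S := by
      by_contra! hcon
      choose z hz using hcon
      have h1 : (Set.range fun i => (Sum.inl (i, z i) : (Fin n × Z) ⊕ Bool)).ncard = n := by
        rw [← Set.image_univ, Set.ncard_image_of_injective, Set.ncard_univ, Nat.card_fin]
        intro i j hij
        exact (Prod.mk.inj (Sum.inl_injective hij)).1
      have h2 := Set.ncard_le_ncard (Set.range_subset_iff.2 hz) (Set.toFinite S)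
      omega
    -- Putting `s` in place of `y` at link `i₀` makes the path switch from powers of `g` applied to
    -- `a` to powers applied to `b`.
    refine ⟨Sum.elim (fun p => (g ^ (p.1 : ℕ)) (if p.1 = i₀ then s p.2 else y p.2))
      fun j => if j then (g ^ n) b else a,
      ⟨fun j => (g ^ (j : ℕ)) (if (j : ℕ) ≤ i₀ then a else b), ⟨?_, ?_⟩, fun i => ?_⟩, ?_⟩
    · simp
    · simp
    · have hstep : K (fun z => if i = i₀ then s z else y z) (if (i : ℕ) ≤ i₀ then a else b)
          (g (if (i : ℕ) + 1 ≤ i₀ then a else b)) := by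
        rcases lt_trichotomy (i : ℕ) i₀ with h | h | h
        · rw [if_pos h.le, if_pos (by omega)]
          simpa [Fin.ext_iff, h.ne] using ha
        · rw [if_pos h.le, if_neg (by omega)]
          simpa [Fin.ext_iff, h] using hs
        · rw [if_neg (by omega), if_neg (by omega)]
          simpa [Fin.ext_iff, h.ne'] using hb
      have := (hinv (g ^ (i : ℕ)) (G.pow_mem hg _) _ _ _).2 hstep
      rw [← Equiv.Perm.mul_apply, ← pow_succ] at this
      exact this
    · rintro (⟨i, z⟩ | j) hj
      · have : i ≠ i₀ := fun h => hi₀ z (h ▸ hj)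
        simp [t, this]
      · rfl
  -- With the parameters of `t` itself no switch is possible: functionality at `a` propagates along
  -- the path.
  have key : ∀ j : ℕ, ∀ hj : j < n + 1, c ⟨j, hj⟩ = (g ^ j) a := by
    intro j
    induction j with
    | zero => intro _; simpa [t] using hc0
    | succ j ih =>
      intro hj
      have h := hc ⟨j, by omega⟩
      simp only [Fin.castSucc_mk, Fin.succ_mk] at h
      rw [ih] at h
      have h' := hfun ((g ^ j)⁻¹ (c ⟨j + 1, hj⟩)) ((hinv (g ^ j) (G.pow_mem hg _) _ _ _).1 (by
        rw [← Equiv.Perm.mul_apply, mul_inv_cancel, Equiv.Perm.one_apply]; exact h))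
      rw [Equiv.Perm.inv_eq_iff_eq] at h'
      rw [h', pow_succ, Equiv.Perm.mul_apply]
  have := key n (by omega)
  rw [← Fin.last, hcn] at this
  exact hab ((g ^ n).injective (by simpa [t] using this.symm))

end Chain

/-! ### Pp-definable partial functions. -/

section Functions

variable {A : Type u} [Nonempty A] {G : Subgroup (Equiv.Perm A)} {k : ℕ}
  {L : FirstOrder.Language.{v, w}} [L.Structure A]

/-- There are no pp-definable partial functions which move all their arguments. -/
theorem not_isPP_of_function (hA : IsFirstOrderExpansion (canonicalLanguage G k) L A)
    (hsw : HasBoundedStrictWidth L A)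
    (hG : ∀ a b c d : A, a ≠ b → c ≠ d → ∃ g ∈ G, g a = c ∧ g b = d)
    (hcard : ∀ a b : A, ∃ c, c ≠ a ∧ c ≠ b) {m : ℕ} {Γ : (Fin m → A) → A → Prop}
    (hΓ : IsPP L fun x : Fin m ⊕ Unit → A => Γ (x ∘ Sum.inl) (x (Sum.inr ())))
    (hne : ∃ t x, Γ t x) (hfun : ∀ t x x', Γ t x → Γ t x' → x = x')
    (hnot : ∀ t x, Γ t x → ∀ i, x ≠ t i) : False := by
  have hinv : ∀ {m : ℕ} {Γ : (Fin m → A) → A → Prop}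
      (_ : IsPP L fun x : Fin m ⊕ Unit → A => Γ (x ∘ Sum.inl) (x (Sum.inr ()))),
      ∀ h ∈ G, ∀ y c, Γ y c → Γ (h ∘ y) (h c) := by
    intro m Γ hΓ h hh y c
    exact (hΓ.smul_iff hA hh (Sum.elim y fun _ => c)).2
  induction m with
  | zero =>
    obtain ⟨t, x, hx⟩ := hne
    obtain ⟨x', hx', -⟩ := hcard x x
    obtain ⟨g, hg, h, -⟩ := hG x x' x' x hx'.symm hx'
    have h' := hinv hΓ g hg t x hx
    rw [h, Subsingleton.elim (g ∘ t) t] at h'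
    exact hx' (hfun _ _ _ h' hx)
  | succ m ih =>
    have hcons : ∀ (g : Equiv.Perm A) (a : A) (t : Fin m → A),
        g ∘ (Fin.cons a t : Fin (m + 1) → A) = Fin.cons (g a) (g ∘ t) := by
      intro g a t
      funext i
      refine Fin.cases ?_ (fun i => ?_) i <;> simp
    have hinv' : ∀ h ∈ G, ∀ (a : A) (t : Fin m → A) c, Γ (Fin.cons a t) c →
        Γ (Fin.cons (h a) (h ∘ t)) (h c) := by
      intro h hh a t c hc
      rw [← hcons]
      exact hinv hΓ h hh _ _ hc
    -- If the first argument is redundant, it can be dropped and induction applies. Otherwise one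
    -- tail `t` admits two values.
    by_cases hp : ∀ t x x', (∃ u, Γ (Fin.cons u t) x) → (∃ u, Γ (Fin.cons u t) x') → x = x'
    · refine ih (Γ := fun t x => ∃ u, Γ (Fin.cons u t) x) ?_ ?_ hp ?_
      · have h : IsPP L fun x : (Fin m ⊕ Unit) ⊕ Unit → A =>
            Γ (Fin.cons (x (Sum.inr ())) (x ∘ Sum.inl ∘ Sum.inl)) (x (Sum.inl (Sum.inr ()))) := by
          refine (hΓ.comp (Sum.elim (Fin.cons (Sum.inr ()) (Sum.inl ∘ Sum.inl))
            fun _ => Sum.inl (Sum.inr ()))).congr fun x => iff_of_eq (congrArg₂ _ ?_ rfl)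
          funext i
          refine Fin.cases ?_ (fun i => ?_) i <;> simp
        refine h.ex.congr fun x => ⟨fun ⟨u, hu⟩ => ⟨fun _ => u, hu⟩, fun ⟨z, hz⟩ => ⟨z (), hz⟩⟩
      · obtain ⟨t, x, hx⟩ := hne
        exact ⟨Fin.tail t, x, t 0, by rwa [Fin.cons_self_tail]⟩
      · rintro t x ⟨u, hu⟩ i
        simpa using hnot _ _ hu i.succ
    · push Not at hp
      obtain ⟨t, x, x', ⟨u, hu⟩, ⟨u', hu'⟩, hxx⟩ := hp
      -- If `u ≠ x'`, some `h` fixes `u` and sends `x` to `x'`; the parameters `h ∘ t` then provide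
      -- the switch of the chain argument.
      have main : ∀ t x x' u u', Γ (Fin.cons u t) x → Γ (Fin.cons u' t) x' → x ≠ x' →
          u = x' := by
        intro t x x' u u' hu hu' hxx
        by_contra hux
        have huu : u ≠ u' := fun h => hxx (hfun _ _ _ hu (h ▸ hu'))
        obtain ⟨g, hg, h1, h2⟩ := hG u u' x x' huu hxx
        have hux' : x ≠ u := hnot _ _ hu 0
        obtain ⟨h, hh, h3, h4⟩ := hG u x u x' hux'.symm hux
        have hs := hinv' h hh _ _ _ hu
        rw [h3, h4] at hs
        refine not_isPP_of_chain hA hsw (K := fun y a c => Γ (Fin.cons a y) c) hg (y := t)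
          (s := h ∘ t) huu (by rwa [h1]) (by rwa [h2]) (by rwa [h2])
          (fun c hc => by rw [h1]; exact hfun _ _ _ hc hu) ?_
        refine (hΓ.comp (Sum.elim (Fin.cons (Sum.inr false) Sum.inl)
          fun _ => Sum.inr true)).congr fun x => iff_of_eq (congrArg₂ _ ?_ rfl)
        funext i
        refine Fin.cases ?_ (fun i => ?_) i <;> simp
      have e₁ := main t x x' u u' hu hu' hxx
      have e₂ := main t x' x u' u hu' hu hxx.symm
      subst e₁ e₂
      -- With tail `t`, `Γ` now exchanges `u` and `u'`, so its square fixes both. Passing through a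
      -- third point `c` with translated tails sends `u` to `u'`, which is the switch.
      obtain ⟨c, hcu, hcu'⟩ := hcard u u'
      obtain ⟨g, hg, h1, h2⟩ := hG u u' u c hxx.symm hcu.symm
      obtain ⟨h, hh, h3, h4⟩ := hG u u' c u' hxx.symm hcu'
      have hs := hinv' g hg _ _ _ hu
      have hs' := hinv' h hh _ _ _ hu
      rw [h1, h2] at hs
      rw [h3, h4] at hs'
      refine not_isPP_of_chain hA hsw (K := fun y a c => ∃ d, Γ (Fin.cons a (y ∘ Sum.inl)) d ∧
        Γ (Fin.cons d (y ∘ Sum.inr)) c) G.one_mem (y := Sum.elim t t)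
        (s := Sum.elim (g ∘ t) (h ∘ t)) hxx.symm ⟨u', hu, hu'⟩ ⟨u, hu', hu⟩ ⟨c, hs, hs'⟩ ?_ ?_
      · rintro d ⟨e, he, hd⟩
        have := hfun _ _ _ he hu
        subst this
        exact hfun _ _ _ hd hu'
      · have h : IsPP L fun x : ((Fin m ⊕ Fin m) ⊕ Bool) ⊕ Unit → A =>
            Γ (Fin.cons (x (Sum.inl (Sum.inr false))) (x ∘ Sum.inl ∘ Sum.inl ∘ Sum.inl))
              (x (Sum.inr ())) ∧
            Γ (Fin.cons (x (Sum.inr ())) (x ∘ Sum.inl ∘ Sum.inl ∘ Sum.inr))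
              (x (Sum.inl (Sum.inr true))) := by
          refine ((hΓ.comp (Sum.elim (Fin.cons (Sum.inl (Sum.inr false))
            (Sum.inl ∘ Sum.inl ∘ Sum.inl)) fun _ => Sum.inr ())).and
            (hΓ.comp (Sum.elim (Fin.cons (Sum.inr ()) (Sum.inl ∘ Sum.inl ∘ Sum.inr))
              fun _ => Sum.inl (Sum.inr true)))).congr fun x => iff_of_eq (congrArg₂ _
                (congrArg₂ _ ?_ rfl) (congrArg₂ _ ?_ rfl)) <;>
          · funext i
            refine Fin.cases ?_ (fun i => ?_) i <;> simp
        refine h.ex.congr fun x => ⟨fun ⟨u, hu⟩ => ⟨fun _ => u, hu⟩, fun ⟨z, hz⟩ => ⟨z (), hz⟩⟩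

/-- A version of `not_isPP_of_function` for arbitrary finite sets of arguments. -/
theorem exists_eq_of_isPP_function (hA : IsFirstOrderExpansion (canonicalLanguage G k) L A)
    (hsw : HasBoundedStrictWidth L A)
    (hG : ∀ a b c d : A, a ≠ b → c ≠ d → ∃ g ∈ G, g a = c ∧ g b = d)
    (hcard : ∀ a b : A, ∃ c, c ≠ a ∧ c ≠ b) {κ : Type} [Finite κ] {Γ : (κ → A) → A → Prop}
    (hΓ : IsPP L fun x : κ ⊕ Unit → A => Γ (x ∘ Sum.inl) (x (Sum.inr ())))
    (hne : ∃ t x, Γ t x) (hfun : ∀ t x x', Γ t x → Γ t x' → x = x') :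
    ∃ t x, Γ t x ∧ ∃ i, x = t i := by
  by_contra! hnot
  let e := Finite.equivFin κ
  refine not_isPP_of_function hA hsw hG hcard (Γ := fun t x => Γ (t ∘ e) x)
    (hΓ.comp (Sum.map e id)) ?_ (fun t => hfun (t ∘ e)) fun t x h i => ?_
  · obtain ⟨t, x, h⟩ := hne
    exact ⟨t ∘ e.symm, x, by rwa [Function.comp_assoc, e.symm_comp_self, Function.comp_id]⟩
  · simpa using hnot _ _ h (e.symm i)

/-- On an injective orbit, a pp-definable predicate can force an additional variable to be equal to
a member of the tuple only if it always does so. -/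
theorem eq_of_forall_orbit_eq (hA : IsFirstOrderExpansion (canonicalLanguage G k) L A)
    (hsw : HasBoundedStrictWidth L A)
    (hG : ∀ a b c d : A, a ≠ b → c ≠ d → ∃ g ∈ G, g a = c ∧ g b = d)
    (hcard : ∀ a b : A, ∃ c, c ≠ a ∧ c ≠ b) {κ : Type} [Finite κ] {a : κ → A}
    (ha : a.Injective) (hO : IsPP L fun t : κ → A => ∃ g ∈ G, t = g ∘ a)
    {C : (κ → A) → A → Prop}
    (hC : IsPP L fun x : κ ⊕ Unit → A => C (x ∘ Sum.inl) (x (Sum.inr ()))) {j : κ}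
    (haj : C a (a j)) (hCO : ∀ t x, (∃ g ∈ G, t = g ∘ a) → C t x → x = t j) :
    ∀ t x, C t x → x = t j := by
  classical
  by_contra! hne
  obtain ⟨s, x, hsx, hne⟩ := hne
  have hinv : ∀ h ∈ G, ∀ y c, C y c → C (h ∘ y) (h c) := fun h hh y c =>
    (hC.smul_iff hA hh (Sum.elim y fun _ => c)).2
  let glue : A → ({i // i ≠ j} → A) → κ → A := fun x y i => if h : i = j then x else y ⟨i, h⟩
  have glue_self : ∀ t : κ → A, glue (t j) (fun i => t i) = t := by
    intro t
    funext i
    by_cases h : i = j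
    · simp [glue, h]
    · simp [glue, h]
  have glue_comp : ∀ (g : Equiv.Perm A) x y, g ∘ glue x y = glue (g x) (g ∘ y) := by
    intro g x y
    funext i
    by_cases h : i = j <;> simp [glue, h]
  let y₀ : {i // i ≠ j} → A := fun i => a i
  -- The question is whether the orbit leaves entry `j` free once the others are fixed. If so, `C`
  -- carries `a j` to itself and `b` to itself, and a translate of `(s, x)` is the switch.
  by_cases hex : ∃ b, b ≠ a j ∧ ∃ g ∈ G, glue b y₀ = g ∘ a
  · obtain ⟨b, hb, g, hg, hgb⟩ := hex
    obtain ⟨h, hh, h1, h2⟩ := hG (s j) x (a j) b hne.symm hb.symm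
    refine not_isPP_of_chain hA hsw (K := fun y x c => C (glue x y) c) G.one_mem (y := y₀)
      (s := fun i => h (s i)) hb.symm ?_ ?_ ?_ ?_ ?_
    · change C (glue (a j) fun i => a i) (a j)
      rwa [glue_self]
    · have := hinv g hg _ _ haj
      rw [← hgb] at this
      have e : g (a j) = b := by
        have := congrFun hgb j
        simpa [glue] using this.symm
      rwa [e] at this
    · have := hinv h hh _ _ hsx
      rw [h2, ← glue_self (h ∘ s), Function.comp_apply, h1] at this
      exact this
    · intro c hc
      have e : glue (a j) y₀ = a := glue_self a
      rw [e] at hc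
      exact hCO a c ⟨1, G.one_mem, rfl⟩ hc
    · refine (hC.comp (Sum.elim (fun i => if h : i = j then Sum.inr false else Sum.inl ⟨i, h⟩)
        fun _ => Sum.inr true)).congr fun x => iff_of_eq (congrArg₂ _ ?_ rfl)
      funext i
      by_cases h : i = j <;> simp [glue, h]
  -- Here the orbit is the graph of a function computing entry `j` from the others, whose value must
  -- be one of its arguments; this contradicts injectivity of `a`.
  · push Not at hex
    obtain ⟨y, z, ⟨g, hg, e⟩, i, hi⟩ := exists_eq_of_isPP_function hA hsw hG hcard
      (Γ := fun y x => ∃ g ∈ G, glue x y = g ∘ a) (by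
        refine (hO.comp (fun i => if h : i = j then Sum.inr () else Sum.inl ⟨i, h⟩)).congr
          fun x => ?_
        rw [show glue (x (Sum.inr ())) (x ∘ Sum.inl) =
          x ∘ fun i => if h : i = j then Sum.inr () else Sum.inl ⟨i, h⟩ from by
            funext i
            by_cases h : i = j <;> simp [glue, h] ])
      ⟨y₀, a j, 1, G.one_mem, glue_self a⟩ (by
        have key : ∀ y x, (∃ g ∈ G, glue x y = g ∘ a) → ∀ g ∈ G, y = g ∘ y₀ → x = g (a j) := by
          rintro y x hx g hg rfl
          have h := hx
          rw [show x = g (g⁻¹ x) by rw [← Equiv.Perm.mul_apply, mul_inv_cancel]; rfl, ← glue_comp,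
            smul_orbit_iff hg] at h
          by_contra hne
          obtain ⟨g', hg', e⟩ := h
          refine hex (g⁻¹ x) (fun h' => hne ?_) g' hg' e
          rw [← h', ← Equiv.Perm.mul_apply, mul_inv_cancel]; rfl
        intro y x x' hx hx'
        obtain ⟨g, hg, e⟩ := hx
        have hy : y = g ∘ y₀ := by
          funext i
          have := congrFun e i
          simpa [glue, i.2] using this
        rw [key y x ⟨g, hg, e⟩ g hg hy, key y x' hx' g hg hy])
    have h1 := congrFun e j
    have h2 := congrFun e i
    simp only [glue, dif_pos, dif_neg i.2, Function.comp_apply] at h1 h2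
    exact i.2 (ha (g.injective (h2.symm.trans (hi.symm.trans h1))))

end Functions

/-! ### Violating equalities inside pp-definable predicates. -/

section Separation

variable {A : Type u} [Nonempty A] {G : Subgroup (Equiv.Perm A)} {k : ℕ}
  {L : FirstOrder.Language.{v, w}} [L.Structure A]

/-- Membership of a tuple in an injective orbit does not imply equalities in pp-definable
predicates. -/
theorem exists_orbit_and_ne (hA : IsFirstOrderExpansion (canonicalLanguage G k) L A)
    (hsw : HasBoundedStrictWidth L A)
    (hG : ∀ a b c d : A, a ≠ b → c ≠ d → ∃ g ∈ G, g a = c ∧ g b = d)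
    (hcard : ∀ a b : A, ∃ c, c ≠ a ∧ c ≠ b) {ι κ : Type} [Finite ι] [Finite κ] {a : κ → A}
    (ha : a.Injective) (hO : IsPP L fun t : κ → A => ∃ g ∈ G, t = g ∘ a)
    {D : (ι → A) → Prop} (hD : IsPP L D) (f : κ → ι) (p q : ι)
    (h₁ : ∃ x, D x ∧ ∃ g ∈ G, x ∘ f = g ∘ a) (h₂ : ∃ x, D x ∧ x p ≠ x q) :
    ∃ x, D x ∧ (∃ g ∈ G, x ∘ f = g ∘ a) ∧ x p ≠ x q := by
  by_contra! hcon
  let C : (κ → A) → A → A → Prop := fun t y z => ∃ x, D x ∧ x ∘ f = t ∧ x p = y ∧ x q = z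
  have hC : IsPP L fun x : κ ⊕ Bool → A =>
      C (x ∘ Sum.inl) (x (Sum.inr false)) (x (Sum.inr true)) := by
    refine (hD.image (Sum.elim f fun b => if b then q else p)).congr fun x => ?_
    refine exists_congr fun y => and_congr_right fun _ => ?_
    simp [funext_iff, Sum.forall]
  have hinv : ∀ h ∈ G, ∀ t y z, C t y z → C (h ∘ t) (h y) (h z) := by
    rintro h hh _ _ _ ⟨x, hx, rfl, rfl, rfl⟩
    exact ⟨h ∘ x, (hD.smul_iff hA hh x).2 hx, rfl, rfl, rfl⟩
  have hCO : ∀ t y z, (∃ g ∈ G, t = g ∘ a) → C t y z → y = z := by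
    rintro _ _ _ ht ⟨x, hx, rfl, rfl, rfl⟩
    exact hcon x hx ht
  obtain ⟨c, hc⟩ : ∃ c, C a c c := by
    obtain ⟨x, hx, g, hg, e⟩ := h₁
    have hCx : C (g ∘ a) (x p) (x q) := ⟨x, hx, e, rfl, rfl⟩
    have := hinv g⁻¹ (G.inv_mem hg) _ _ _ hCx
    rw [← hcon x hx ⟨g, hg, e⟩, ← Function.comp_assoc, ← Equiv.Perm.coe_mul, inv_mul_cancel] at this
    exact ⟨_, this⟩
  obtain ⟨s, y, z, hs, hyz⟩ : ∃ s y z, C s y z ∧ y ≠ z := by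
    obtain ⟨x, hx, hpq⟩ := h₂
    exact ⟨_, _, _, ⟨x, hx, rfl, rfl, rfl⟩, hpq⟩
  -- Two diagonal values over `a` could be switched by a translate of the off-diagonal pair `(y,
  -- z)`.
  have huniq : ∀ c', C a c' c' → c' = c := by
    intro c' hc'
    by_contra hne
    obtain ⟨h, hh, e₁, e₂⟩ := hG y z c c' hyz (Ne.symm hne)
    refine not_isPP_of_chain hA hsw G.one_mem (y := a) (s := h ∘ s) (Ne.symm hne) hc hc' ?_ ?_ hC
    · have := hinv h hh _ _ _ hs
      rwa [e₁, e₂] at this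
    · intro d hd
      exact (hCO a c d ⟨1, G.one_mem, rfl⟩ hd).symm
  have huniq' : ∀ g ∈ G, ∀ c', C (g ∘ a) c' c' → c' = g c := by
    intro g hg c' hc'
    have := hinv g⁻¹ (G.inv_mem hg) _ _ _ hc'
    rw [← Function.comp_assoc, ← Equiv.Perm.coe_mul, inv_mul_cancel] at this
    rw [← huniq _ this, ← Equiv.Perm.mul_apply, mul_inv_cancel]
    rfl
  -- The common value is thus a function of the tuple in the orbit, so it is one of its entries.
  -- `eq_of_forall_orbit_eq` then forces both coordinates to be that entry everywhere, including at
  -- `(s, y, z)`.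
  obtain ⟨t, x, ⟨⟨g, hg, rfl⟩, ht⟩, j, hj⟩ := exists_eq_of_isPP_function hA hsw hG hcard
    (Γ := fun t x => (∃ g ∈ G, t = g ∘ a) ∧ C t x x)
    ((hO.comp Sum.inl).and (hC.comp (Sum.elim Sum.inl fun _ => Sum.inr ())))
    ⟨a, c, ⟨1, G.one_mem, rfl⟩, hc⟩ (by
      rintro _ x x' ⟨⟨g, hg, rfl⟩, h⟩ ⟨-, h'⟩
      rw [huniq' g hg _ h, huniq' g hg _ h'])
  have hcj : c = a j := g.injective ((huniq' g hg _ ht).symm.trans hj)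
  have hfun : ∀ t y z, (∃ g ∈ G, t = g ∘ a) → C t y z → y = t j ∧ z = t j := by
    rintro t y z ht h
    obtain rfl := hCO t y z ht h
    obtain ⟨g, hg, rfl⟩ := ht
    rw [huniq' g hg _ h, hcj]
    exact ⟨rfl, rfl⟩
  have hC₁ : IsPP L fun x : κ ⊕ Unit → A => ∃ z, C (x ∘ Sum.inl) (x (Sum.inr ())) z := by
    refine (IsPP.ex (κ := Unit) (hC.comp (Sum.elim (Sum.inl ∘ Sum.inl)
      fun b => if b then Sum.inr () else Sum.inl (Sum.inr ())))).congr fun x => ?_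
    exact ⟨fun ⟨u, hu⟩ => ⟨fun _ => u, hu⟩, fun ⟨z, hz⟩ => ⟨z (), hz⟩⟩
  have hC₂ : IsPP L fun x : κ ⊕ Unit → A => ∃ z, C (x ∘ Sum.inl) z (x (Sum.inr ())) := by
    refine (IsPP.ex (κ := Unit) (hC.comp (Sum.elim (Sum.inl ∘ Sum.inl)
      fun b => if b then Sum.inl (Sum.inr ()) else Sum.inr ()))).congr fun x => ?_
    exact ⟨fun ⟨u, hu⟩ => ⟨fun _ => u, hu⟩, fun ⟨z, hz⟩ => ⟨z (), hz⟩⟩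
  have r₁ := eq_of_forall_orbit_eq hA hsw hG hcard ha hO (C := fun t y => ∃ z, C t y z) hC₁
    (j := j) ⟨_, hcj ▸ hc⟩ (fun t y ht ⟨z, h⟩ => (hfun t y z ht h).1) s y ⟨z, hs⟩
  have r₂ := eq_of_forall_orbit_eq hA hsw hG hcard ha hO (C := fun t z => ∃ y, C t y z) hC₂
    (j := j) ⟨_, hcj ▸ hc⟩ (fun t z ht ⟨y, h⟩ => (hfun t y z ht h).2) s z ⟨y, hs⟩
  exact hyz (r₁.trans r₂.symm)

theorem isPP_ne (hA : IsFirstOrderExpansion (canonicalLanguage G k) L A) (hk : 2 ≤ k)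
    (hG : ∀ a b c d : A, a ≠ b → c ≠ d → ∃ g ∈ G, g a = c ∧ g b = d)
    (hcard : ∀ a b : A, ∃ c, c ≠ a ∧ c ≠ b) {ι : Type} (p q : ι) :
    IsPP L fun x : ι → A => x p ≠ x q := by
  obtain ⟨b, hb, -⟩ := hcard (Classical.arbitrary A) (Classical.arbitrary A)
  refine ((isPP_orbit hA (by simpa using hk) ![b, Classical.arbitrary A]).comp ![p, q]).congr
    fun x => ⟨fun h => ?_, ?_⟩
  · obtain ⟨g, hg, h1, h2⟩ := hG _ _ _ _ hb h
    exact ⟨g, hg, funext fun i => by fin_cases i <;> simp [h1, h2]⟩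
  · rintro ⟨g, -, e⟩ h
    have h1 := congrFun e 0
    have h2 := congrFun e 1
    simp only [Function.comp_apply, Matrix.cons_val_zero, Matrix.cons_val_one] at h1 h2
    exact hb (g.injective (h1.symm.trans (h.trans h2)))

/-- If a pp-definable predicate does not imply any of finitely many equalities, then it has a tuple
that violates all of them. -/
theorem exists_forall_ne (hA : IsFirstOrderExpansion (canonicalLanguage G k) L A) (hk : 2 ≤ k)
    (hsw : HasBoundedStrictWidth L A)
    (hG : ∀ a b c d : A, a ≠ b → c ≠ d → ∃ g ∈ G, g a = c ∧ g b = d)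
    (hcard : ∀ a b : A, ∃ c, c ≠ a ∧ c ≠ b) {ι : Type} [Finite ι]
    {D : (ι → A) → Prop} (hD : IsPP L D) (hne : ∃ x, D x) (E : Set (ι × ι))
    (hE : ∀ e ∈ E, ∃ x, D x ∧ x e.1 ≠ x e.2) : ∃ x, D x ∧ ∀ e ∈ E, x e.1 ≠ x e.2 := by
  induction E, E.toFinite using Set.Finite.induction_on generalizing D with
  | empty => simpa using hne
  | @insert e E _ _ ih =>
    obtain ⟨x, hx, h⟩ := hE e (Set.mem_insert _ _)
    -- By 2-transitivity the pairs of distinct elements form one injective orbit, so imposing one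
    -- inequality forces no other equality.
    obtain ⟨y, hy, h'⟩ := ih (hD.and (isPP_ne hA hk hG hcard e.1 e.2)) ⟨x, hx, h⟩ fun e' he' => by
      obtain ⟨b, hb, -⟩ := hcard (Classical.arbitrary A) (Classical.arbitrary A)
      have hinj : Function.Injective ![b, Classical.arbitrary A] := by
        intro i j hij
        fin_cases i <;> fin_cases j <;> simp_all
      obtain ⟨y, hy, ⟨g, hg, e₁⟩, hne⟩ := exists_orbit_and_ne hA hsw hG hcard hinj
        (isPP_orbit hA (by simpa using hk) _) hD ![e.1, e.2] e'.1 e'.2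
        (by
          obtain ⟨g, hg, h1, h2⟩ := hG _ _ _ _ hb h
          refine ⟨x, hx, g, hg, ?_⟩
          funext i
          fin_cases i <;> simp [h1, h2])
        (hE e' (Set.mem_insert_of_mem _ he'))
      refine ⟨y, ⟨hy, fun h => ?_⟩, hne⟩
      have h1 := congrFun e₁ 0
      have h2 := congrFun e₁ 1
      simp only [Function.comp_apply, Matrix.cons_val_zero, Matrix.cons_val_one] at h1 h2
      exact hb (g.injective (h1.symm.trans (h.trans h2)))
    refine ⟨y, hy.1, ?_⟩
    rintro e' (rfl | he')
    · exact hy.2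
    · exact h' e' he'

/-- A structure with at least three elements and bounded strict width is infinite. -/
theorem infinite_of_hasBoundedStrictWidth (hA : IsFirstOrderExpansion (canonicalLanguage G k) L A)
    (hk : 2 ≤ k) (hsw : HasBoundedStrictWidth L A)
    (hG : ∀ a b c d : A, a ≠ b → c ≠ d → ∃ g ∈ G, g a = c ∧ g b = d)
    (hcard : ∀ a b : A, ∃ c, c ≠ a ∧ c ≠ b) : Infinite A := by
  by_contra hfin
  rw [not_infinite_iff_finite] at hfin
  obtain ⟨b, hb, -⟩ := hcard (Classical.arbitrary A) (Classical.arbitrary A)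
  -- The full relation on one variable more than there are elements implies no equality, hence would
  -- contain an injective tuple.
  obtain ⟨x, -, hx⟩ := exists_forall_ne hA hk hsw hG hcard
    (IsPP.true (ι := Fin (Nat.card A + 1))) ⟨fun _ => b, trivial⟩ {e | e.1 ≠ e.2}
    fun e he => ⟨Function.update (fun _ => Classical.arbitrary A) e.1 b, trivial, by
      rw [Function.update_self, Function.update_of_ne (Ne.symm he)]; exact hb⟩
  have hinj : Function.Injective x := fun i j hij => by
    by_contra hne
    exact hx (i, j) hne hij
  have := Nat.card_le_card_of_injective x hinj
  simp at this

end Separation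

/-! ### Working with minimal instances. -/

section Minimal

variable {V : Type} {A : Type u} {J : Instance V A} {k ℓ : ℕ}

theorem Instance.IsMinimal.exists_scope (hJ : J.IsMinimal k ℓ) {κ : Type} [Finite κ] [Nonempty κ]
    (hκ : Nat.card κ ≤ ℓ) (t : κ → V) : ∃ C ∈ J.constraints, ∀ i, t i ∈ C.scope := by
  let e := Finite.equivFin κ
  obtain ⟨C, hC, h⟩ := hJ.1 _ Nat.card_pos hκ (t ∘ e.symm)
  exact ⟨C, hC, fun i => h ⟨e i, by simp⟩⟩

theorem Instance.IsMinimal.exists_rel (hJ : J.IsMinimal k ℓ) {κ : Type} [Finite κ] [Nonempty κ]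
    (hκ : Nat.card κ ≤ k) (t : κ → V) {C₁ C₂ : Constraint V A} (hC₁ : C₁ ∈ J.constraints)
    (hC₂ : C₂ ∈ J.constraints) (h₁ : ∀ i, t i ∈ C₁.scope) (h₂ : ∀ i, t i ∈ C₂.scope)
    {f₁ : C₁.scope → A} (hf₁ : f₁ ∈ C₁.rel) :
    ∃ f₂ ∈ C₂.rel, ∀ i, f₂ ⟨t i, h₂ i⟩ = f₁ ⟨t i, h₁ i⟩ := by
  let e := Finite.equivFin κ
  have h := hJ.2 _ Nat.card_pos hκ (t ∘ e.symm) C₁ hC₁ C₂ hC₂ (fun i => h₁ _) (fun i => h₂ _)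
  obtain ⟨f₂, hf₂, h⟩ := h.subset ⟨f₁, hf₁, rfl⟩
  refine ⟨f₂, hf₂, fun i => ?_⟩
  have := congrFun h (e i)
  simpa using this.symm

theorem Instance.IsMinimal.exists_rel_pair (hJ : J.IsMinimal k ℓ) (hk : 2 ≤ k)
    {C₁ C₂ : Constraint V A} (hC₁ : C₁ ∈ J.constraints) (hC₂ : C₂ ∈ J.constraints) {x y : V}
    (hx₁ : x ∈ C₁.scope) (hy₁ : y ∈ C₁.scope) (hx₂ : x ∈ C₂.scope) (hy₂ : y ∈ C₂.scope)
    {f₁ : C₁.scope → A} (hf₁ : f₁ ∈ C₁.rel) :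
    ∃ f₂ ∈ C₂.rel, f₂ ⟨x, hx₂⟩ = f₁ ⟨x, hx₁⟩ ∧ f₂ ⟨y, hy₂⟩ = f₁ ⟨y, hy₁⟩ := by
  obtain ⟨f₂, hf₂, h⟩ := hJ.exists_rel (by simpa using hk) (fun b : Bool => if b then x else y)
    hC₁ hC₂ (by simp [hx₁, hy₁]) (by simp [hx₂, hy₂]) hf₁
  exact ⟨f₂, hf₂, h true, h false⟩

theorem Instance.IsMinimal.exists_scope_triple (hJ : J.IsMinimal k ℓ) (hℓ : 3 ≤ ℓ) (x y z : V) :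
    ∃ C ∈ J.constraints, x ∈ C.scope ∧ y ∈ C.scope ∧ z ∈ C.scope := by
  obtain ⟨C, hC, h⟩ := hJ.exists_scope (by simpa using hℓ) ![x, y, z]
  exact ⟨C, hC, h 0, h 1, h 2⟩

end Minimal

/-! ### Two-element domains. -/

section TwoElements

variable {A : Type u} [Nonempty A] {G : Subgroup (Equiv.Perm A)} {k : ℕ}
  {L : FirstOrder.Language.{v, w}} [L.Structure A]

/-- Over a two-element set, bounded strict width implies that pp-definable predicates are
determined by their binary projections. -/
theorem IsPP.of_forall_pair (hA : IsFirstOrderExpansion (canonicalLanguage G k) L A)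
    (hsw : HasBoundedStrictWidth L A)
    (hG : ∀ a b c d : A, a ≠ b → c ≠ d → ∃ g ∈ G, g a = c ∧ g b = d)
    (hcard : ∀ a b c : A, a ≠ c → b ≠ c → a = b) {ι : Type} [Finite ι] {D : (ι → A) → Prop}
    (hD : IsPP L D) (hne : ∃ x, D x) (p : ι → A)
    (hp : ∀ i j, ∃ x, D x ∧ x i = p i ∧ x j = p j) : D p := by
  by_contra hDp
  -- A minimal set on which `p` cannot be matched contains three distinct coordinates `i`, `j`, `l`.
  -- Dropping `j`, `i` or `l` gives `x`, `y`, `z`; the first two form the links of the chain, and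
  -- `z`, which agrees with `p` at `i` and `j`, is the switch.
  obtain ⟨S, hS⟩ := (Set.toFinite {S : Set ι | ¬ ∃ x, D x ∧ ∀ i ∈ S, x i = p i}).exists_minimal
    ⟨Set.univ, fun ⟨x, hx, h⟩ => hDp (by rwa [← show x = p from funext fun i => h i trivial])⟩
  have hbad := hS.prop
  have hmin : ∀ i ∈ S, ∃ x, D x ∧ ∀ j ∈ S, j ≠ i → x j = p j := by
    intro i hi
    by_contra! hcon
    refine (hS.le_of_le (y := S \ {i}) ?_ Set.sdiff_subset hi).2 rfl
    rintro ⟨x, hx, h⟩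
    obtain ⟨j, hj, hji, hne⟩ := hcon x hx
    exact hne (h j ⟨hj, hji⟩)
  obtain ⟨i, hi⟩ : S.Nonempty := by
    by_contra hemp
    rw [Set.not_nonempty_iff_eq_empty] at hemp
    obtain ⟨x, hx⟩ := hne
    exact hbad ⟨x, hx, by simp [hemp]⟩
  obtain ⟨j, hj, hij⟩ : ∃ j ∈ S, j ≠ i := by
    by_contra! hcon
    obtain ⟨x, hx, h, -⟩ := hp i i
    exact hbad ⟨x, hx, fun j hj => by rw [hcon j hj, h]⟩
  obtain ⟨l, hl, hli, hlj⟩ : ∃ l ∈ S, l ≠ i ∧ l ≠ j := by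
    by_contra! hcon
    obtain ⟨x, hx, h, h'⟩ := hp i j
    refine hbad ⟨x, hx, fun l hl => ?_⟩
    by_cases hli : l = i
    · rw [hli, h]
    · rw [hcon l hl hli, h']
  obtain ⟨x, hx, hxp⟩ := hmin j hj
  obtain ⟨y, hy, hyp⟩ := hmin i hi
  obtain ⟨z, hz, hzp⟩ := hmin l hl
  have hxj : x j ≠ p j := fun h => hbad ⟨x, hx, fun t ht => by
    by_cases htj : t = j
    · rw [htj, h]
    · exact hxp t ht htj⟩
  have hyi : p i ≠ y i := fun h => hbad ⟨y, hy, fun t ht => by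
    by_cases hti : t = i
    · rw [hti, h]
    · exact hyp t ht hti⟩
  obtain ⟨g, hg, h1, h2⟩ := hG _ _ _ _ hyi hxj
  let Z := {t // t ∈ S ∧ t ≠ i ∧ t ≠ j}
  refine not_isPP_of_chain hA hsw (Z := Z)
    (K := fun t a c => ∃ x, D x ∧ (∀ s : Z, x s = t s) ∧ x i = a ∧ x j = c) hg
    (y := fun t => p t) (s := fun t => z t) hyi
    ⟨x, hx, fun t => hxp _ t.2.1 t.2.2.2, hxp i hi hij.symm, h1.symm⟩
    ⟨y, hy, fun t => hyp _ t.2.1 t.2.2.1, rfl, by rw [h2, hyp j hj hij]⟩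
    ⟨z, hz, fun t => rfl, hzp i hi hli.symm, by rw [h2, hzp j hj hlj.symm]⟩ ?_ ?_
  · rintro _ ⟨x', hx', h, h', rfl⟩
    rw [h1]
    refine hcard _ _ (p j) (fun h'' => hbad ⟨x', hx', fun t ht => ?_⟩) hxj
    by_cases hti : t = i
    · rw [hti, h']
    by_cases htj : t = j
    · rw [htj, h'']
    exact h ⟨t, ht, hti, htj⟩
  · refine (hD.image (Sum.elim (fun t : Z => (t : ι)) fun b => if b then j else i)).congr
      fun x => exists_congr fun y => and_congr_right fun _ => ?_
    simp [Sum.forall]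

/-- Over a two-element set, bounded strict width implies that minimal instances have solutions. -/
theorem exists_isSolution_of_two_elements
    (hA : IsFirstOrderExpansion (canonicalLanguage G k) L A) (hsw : HasBoundedStrictWidth L A)
    (hG : ∀ a b c d : A, a ≠ b → c ≠ d → ∃ g ∈ G, g a = c ∧ g b = d)
    (hcard : ∀ a b c : A, a ≠ c → b ≠ c → a = b) (htriv : ∀ a : A, ∃ b, a ≠ b)
    {V : Type} [Finite V] {J : Instance V A} (hJ : ∀ C ∈ J.constraints, IsPP L (· ∈ C.rel))
    {m ℓ : ℕ} (hm : 2 ≤ m) (hℓ : 3 ≤ ℓ) (hmin : J.IsMinimal m ℓ) (hJne : J.Nontrivial) :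
    ∃ f, J.IsSolution f := by
  have hG₁ : ∀ a b : A, ∃ g ∈ G, g a = b := fun a b => by
    obtain ⟨a', ha'⟩ := htriv a
    obtain ⟨b', hb'⟩ := htriv b
    obtain ⟨g, hg, h, -⟩ := hG a a' b b' ha' hb'
    exact ⟨g, hg, h⟩
  let R : V → V → A → A → Prop := fun x y a b => ∃ C ∈ J.constraints, ∃ (hx : x ∈ C.scope)
    (hy : y ∈ C.scope), ∃ f ∈ C.rel, f ⟨x, hx⟩ = a ∧ f ⟨y, hy⟩ = b
  have hRC : ∀ {x y a b}, R x y a b → ∀ C ∈ J.constraints, ∀ (hx : x ∈ C.scope)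
      (hy : y ∈ C.scope), ∃ f ∈ C.rel, f ⟨x, hx⟩ = a ∧ f ⟨y, hy⟩ = b := by
    rintro x y _ _ ⟨C, hC, hx, hy, f, hf, rfl, rfl⟩ C' hC' hx' hy'
    exact hmin.exists_rel_pair hm hC hC' hx hy hx' hy' hf
  have hRG : ∀ g ∈ G, ∀ {x y a b}, R x y a b → R x y (g a) (g b) := by
    rintro g hg x y _ _ ⟨C, hC, hx, hy, f, hf, rfl, rfl⟩
    exact ⟨C, hC, hx, hy, g ∘ f, ((hJ C hC).smul_iff hA hg f).2 hf, rfl, rfl⟩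
  have hRsymm : ∀ {x y a b}, R x y a b → R y x b a := by
    rintro x y _ _ ⟨C, hC, hx, hy, f, hf, rfl, rfl⟩
    exact ⟨C, hC, hy, hx, f, hf, rfl, rfl⟩
  have hRne : ∀ x y a, ∃ b, R x y a b := by
    intro x y a
    obtain ⟨C, hC, hx, hy, -⟩ := hmin.exists_scope_triple hℓ x y y
    obtain ⟨f, hf⟩ := hJne C hC
    obtain ⟨g, hg, h⟩ := hG₁ (f ⟨x, hx⟩) a
    exact ⟨_, h ▸ hRG g hg ⟨C, hC, hx, hy, f, hf, rfl, rfl⟩⟩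
  -- By 2-transitivity each `R x y` is either the graph of a bijection or all pairs. Values are
  -- propagated from a representative within each class of `Fun`; across classes every pair is
  -- allowed.
  let Fun : V → V → Prop := fun x y => ∀ a b c, R x y a b → R x y a c → b = c
  have hrefl : ∀ x, Fun x x := by
    rintro x _ _ _ ⟨C, hC, hx, hx', f, hf, rfl, rfl⟩ ⟨C', hC', hy, hy', f', hf', h, rfl⟩
    exact h.symm
  have hsymm : ∀ {x y}, Fun x y → Fun y x := by
    intro x y h a b c hb hc
    by_contra hbc
    obtain ⟨g, hg, h1, h2⟩ := hG b c c b hbc (Ne.symm hbc)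
    have h3 := hRG g hg (hRsymm hb)
    rw [h1] at h3
    have h4 := h _ _ _ h3 (hRsymm hc)
    by_cases hab : a = b
    · rw [hab, h1] at h4; exact hbc h4.symm
    · rw [hcard a c b hab (Ne.symm hbc), h2] at h4; exact hbc h4
  have htrans : ∀ {x y z}, Fun x y → Fun y z → Fun x z := by
    intro x y z hxy hyz a b c hb hc
    obtain ⟨C, hC, hx, hy, hz⟩ := hmin.exists_scope_triple hℓ x y z
    obtain ⟨f, hf, h1, rfl⟩ := hRC hb C hC hx hz
    obtain ⟨f', hf', h2, rfl⟩ := hRC hc C hC hx hz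
    have h3 := hxy a _ _ ⟨C, hC, hx, hy, f, hf, h1, rfl⟩ ⟨C, hC, hx, hy, f', hf', h2, rfl⟩
    exact hyz _ _ _ ⟨C, hC, hy, hz, f, hf, rfl, rfl⟩ ⟨C, hC, hy, hz, f', hf', h3.symm, rfl⟩
  let s : Setoid V := ⟨Fun, hrefl, hsymm, htrans⟩
  let rep : V → V := fun x => (Quotient.mk s x).out
  have hrep : ∀ x, Fun (rep x) x := fun x => Quotient.mk_out x
  choose f hf using fun x => hRne (rep x) x (Classical.arbitrary A)
  have key : ∀ x y, R x y (f x) (f y) := by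
    intro x y
    by_cases hxy : Fun x y
    · have hr : rep x = rep y := congrArg Quotient.out (Quotient.sound hxy)
      obtain ⟨C, hC, hr', hx, hy⟩ := hmin.exists_scope_triple hℓ (rep x) x y
      obtain ⟨f₁, hf₁, h1, h2⟩ := hRC (hf x) C hC hr' hx
      refine ⟨C, hC, hx, hy, f₁, hf₁, h2, ?_⟩
      exact hrep y _ _ _ (hr ▸ ⟨C, hC, hr', hy, f₁, hf₁, h1, rfl⟩) (hf y)
    · simp only [Fun, not_forall] at hxy
      obtain ⟨a, b, c, hb, hc, hbc⟩ := hxy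
      obtain ⟨g, hg, h⟩ := hG₁ a (f x)
      have hb' := hRG g hg hb
      have hc' := hRG g hg hc
      rw [h] at hb' hc'
      by_cases hfy : g b = f y
      · rwa [← hfy]
      · rwa [hcard (f y) (g c) (g b) (Ne.symm hfy) fun h => hbc (g.injective h.symm)]
  refine ⟨f, fun C hC => ?_⟩
  exact (hJ C hC).of_forall_pair hA hsw hG hcard (hJne C hC) _ fun i j =>
    hRC (key i j) C hC i.2 j.2

end TwoElements

/-! ### Identifying variables that are forced to be equal. -/

section Contraction

variable {V V' : Type} {A : Type u}

/-- The injective part of the constraint obtained from `C` by identifying variables along `π`. -/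
def Constraint.contract (π : V → V') (C : Constraint V A) : Constraint V' A where
  scope := π '' C.scope
  nonempty := C.nonempty.image π
  rel := {f | (fun x : C.scope => f ⟨π x, Set.mem_image_of_mem π x.2⟩) ∈ C.rel ∧ f.Injective}

/-- The injective instance obtained from `J` by identifying variables along `π`. -/
def Instance.contract (π : V → V') (J : Instance V A) : Instance V' A where
  constraints := Constraint.contract π '' J.constraints
  finite := J.finite.image _

theorem Instance.isInj_contract (π : V → V') (J : Instance V A) : (J.contract π).IsInj := by
  rintro _ ⟨C, -, rfl⟩ x y hxy _ ⟨f, ⟨-, hf⟩, rfl⟩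
  refine hf.comp fun i j hij => ?_
  fin_cases i <;> fin_cases j <;> simp_all

theorem Instance.IsSolution.of_contract {π : V → V'} {J : Instance V A} {f : V' → A}
    (hf : (J.contract π).IsSolution f) : J.IsSolution (f ∘ π) :=
  fun C hC => (hf _ ⟨C, hC, rfl⟩).1

/-- The equivalence relation on the variables of a minimal instance that identifies two variables
if the instance forces them to be equal. -/
def Instance.IsMinimal.eqSetoid {J : Instance V A} {k ℓ : ℕ} (hJ : J.IsMinimal k ℓ) (hk : 2 ≤ k)
    (hℓ : 3 ≤ ℓ) : Setoid V where
  r x y := ∀ C ∈ J.constraints, ∀ (hx : x ∈ C.scope) (hy : y ∈ C.scope), ∀ f ∈ C.rel,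
    f ⟨x, hx⟩ = f ⟨y, hy⟩
  iseqv :=
    { refl := fun _ _ _ _ _ _ _ => rfl
      symm := fun h C hC hx hy f hf => (h C hC hy hx f hf).symm
      trans := by
        intro x y z hxy hyz C hC hx hz f hf
        obtain ⟨C', hC', hx', hy', hz'⟩ := hJ.exists_scope_triple hℓ x y z
        obtain ⟨f', hf', h1, h2⟩ := hJ.exists_rel_pair hk hC hC' hx hz hx' hz' hf
        rw [← h1, ← h2, hxy C' hC' hx' hy' f' hf', hyz C' hC' hy' hz' f' hf'] }

/-- Variables are exchanged one at a time. Each exchange needs a scope containing the current `k`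
variables together with the new one, which is the role of `k + 1 ≤ ℓ`. -/
theorem Instance.IsMinimal.exists_rel_of_equiv {J : Instance V A} {k ℓ : ℕ} (hJ : J.IsMinimal k ℓ)
    (hk : 2 ≤ k) (hℓ : k + 1 ≤ ℓ) {κ : Type} [Finite κ] [Nonempty κ]
    (hκ : Nat.card κ ≤ k) {t₁ t₂ : κ → V}
    (ht : ∀ i, (hJ.eqSetoid hk (by omega)).r (t₁ i) (t₂ i)) {C₁ C₂ : Constraint V A}
    (hC₁ : C₁ ∈ J.constraints) (hC₂ : C₂ ∈ J.constraints) (h₁ : ∀ i, t₁ i ∈ C₁.scope)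
    (h₂ : ∀ i, t₂ i ∈ C₂.scope) {f₁ : C₁.scope → A} (hf₁ : f₁ ∈ C₁.rel) :
    ∃ f₂ ∈ C₂.rel, ∀ i, f₂ ⟨t₂ i, h₂ i⟩ = f₁ ⟨t₁ i, h₁ i⟩ := by
  classical
  have key : ∀ s : Finset κ, ∃ C ∈ J.constraints,
      ∃ h : ∀ i, (if i ∈ s then t₂ i else t₁ i) ∈ C.scope,
      ∃ f ∈ C.rel, ∀ i, f ⟨_, h i⟩ = f₁ ⟨t₁ i, h₁ i⟩ := by
    intro s
    induction s using Finset.induction_on with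
    | empty => exact ⟨C₁, hC₁, by simpa using h₁, f₁, hf₁, by simp⟩
    | insert j s hj ih =>
      obtain ⟨C, hC, h, f, hf, hff⟩ := ih
      obtain ⟨C', hC', h'⟩ := hJ.exists_scope (by rw [Finite.card_option]; omega)
        (fun o : Option κ => o.elim (t₂ j) fun i => if i ∈ s then t₂ i else t₁ i)
      obtain ⟨f', hf', hff'⟩ := hJ.exists_rel hκ _ hC hC' h (fun i => h' (some i)) hf
      have hsc : ∀ i, (if i ∈ insert j s then t₂ i else t₁ i) ∈ C'.scope := by
        intro i
        by_cases hij : i = j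
        · subst hij; simpa using h' none
        · simpa [hij] using h' (some i)
      refine ⟨C', hC', hsc, f', hf', fun i => ?_⟩
      rw [← hff i, ← hff' i]
      by_cases hij : i = j
      · subst hij
        have e := ht i C' hC' (by simpa [hj] using h' (some i)) (h' none) f' hf'
        simp only [Finset.mem_insert_self, if_true, hj, if_false]
        exact e.symm
      · simp [hij]
  have := Fintype.ofFinite κ
  obtain ⟨C, hC, h, f, hf, hff⟩ := key Finset.univ
  simp only [Finset.mem_univ, if_true] at h hff
  obtain ⟨f₂, hf₂, h'⟩ := hJ.exists_rel hκ _ hC hC₂ h h₂ hf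
  exact ⟨f₂, hf₂, fun i => (h' i).trans (hff i)⟩

variable {J : Instance V A} {m ℓ : ℕ}

/-- Any `f` in the constraint is constant on classes and so descends to the quotient; `hne` makes
the descended map injective. -/
theorem Instance.IsMinimal.exists_contract (hmin : J.IsMinimal m ℓ) (hm : 2 ≤ m) (hℓ : 3 ≤ ℓ)
    {C : Constraint V A} (hC : C ∈ J.constraints) {f : C.scope → A} (hf : f ∈ C.rel)
    (hne : ∀ x y : C.scope, ¬ (hmin.eqSetoid hm hℓ).r x y → f x ≠ f y) :
    ∃ f' ∈ (C.contract (Quotient.mk (hmin.eqSetoid hm hℓ))).rel,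
      ∀ x : C.scope, f' ⟨_, Set.mem_image_of_mem _ x.2⟩ = f x := by
  set s := hmin.eqSetoid hm hℓ
  choose u hu huπ using fun v : Quotient.mk s '' C.scope => v.2
  have key : ∀ x : C.scope,
      f ⟨u ⟨_, Set.mem_image_of_mem _ x.2⟩, hu _⟩ = f x := by
    intro x
    exact Quotient.exact (huπ ⟨_, Set.mem_image_of_mem _ x.2⟩) C hC (hu _) x.2 f hf
  refine ⟨fun v => f ⟨u v, hu v⟩, ⟨?_, ?_⟩, key⟩
  · convert hf using 1
    exact funext key
  · intro v v' hvv
    by_contra hne'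
    refine hne ⟨u v, hu v⟩ ⟨u v', hu v'⟩ (fun h => hne' (Subtype.ext ?_)) hvv
    rw [← huπ v, ← huπ v']
    exact Quotient.sound h

theorem Instance.IsMinimal.exists_ne_of_not_eqSetoid (hmin : J.IsMinimal m ℓ) (hm : 2 ≤ m)
    (hℓ : 3 ≤ ℓ) {C : Constraint V A} (hC : C ∈ J.constraints) {x y : C.scope}
    (hxy : ¬ (hmin.eqSetoid hm hℓ).r x y) : ∃ f ∈ C.rel, f x ≠ f y := by
  by_contra! hcon
  refine hxy fun C' hC' hx hy f' hf' => ?_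
  obtain ⟨f, hf, h1, h2⟩ := hmin.exists_rel_pair hm hC' hC hx hy x.2 y.2 hf'
  rw [← h1, ← h2]
  exact hcon f hf

end Contraction

/-! ### Contraction preserves non-triviality and minimality. -/

section Reduction

variable {A : Type u} [Nonempty A] {G : Subgroup (Equiv.Perm A)} {k : ℕ}
  {L : FirstOrder.Language.{v, w}} [L.Structure A]

/-- Injectivity is a finite conjunction of pp-definable inequalities, and identifying variables does
not increase arity. -/
theorem Instance.isOf_contract (hA : IsFirstOrderExpansion (canonicalLanguage G k) L A)
    (hk : 2 ≤ k) (hG : ∀ a b c d : A, a ≠ b → c ≠ d → ∃ g ∈ G, g a = c ∧ g b = d)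
    (hcard : ∀ a b : A, ∃ c, c ≠ a ∧ c ≠ b) {V V' : Type} [Finite V] [Finite V'] (π : V → V')
    {J : Instance V A} {ℓ : ℕ} (hJ : J.IsOf (ppLanguage L A ℓ)) :
    (J.contract π).IsOf (ppLanguage L A ℓ) := by
  rintro _ ⟨C, hC, rfl⟩
  obtain ⟨hP, hn⟩ := Constraint.isOf_ppLanguage_iff.1 (hJ C hC)
  have hle : Nat.card (C.contract π).scope ≤ Nat.card C.scope :=
    Set.ncard_image_le (Set.toFinite _)
  refine Constraint.isOf_ppLanguage_iff.2 ⟨?_, hn.imp hle.trans fun ⟨m, hm, h⟩ =>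
    ⟨m, hle.trans hm, h⟩⟩
  refine ((hP.comp fun x => (⟨π x, Set.mem_image_of_mem π x.2⟩ : (C.contract π).scope)).and
    (IsPP.all fun p : {p : (C.contract π).scope × (C.contract π).scope // p.1 ≠ p.2} =>
      isPP_ne hA hk hG hcard p.1.1 p.1.2)).congr fun f => and_congr Iff.rfl ?_
  constructor
  · exact fun h p => h.ne p.2
  · intro h x y hxy
    by_contra hne
    exact h ⟨(x, y), hne⟩ hxy

variable {V : Type} [Finite V] {J : Instance V A} {m ℓ : ℕ}

theorem Instance.IsMinimal.nontrivial_contract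
    (hA : IsFirstOrderExpansion (canonicalLanguage G k) L A) (hk : 2 ≤ k)
    (hsw : HasBoundedStrictWidth L A)
    (hG : ∀ a b c d : A, a ≠ b → c ≠ d → ∃ g ∈ G, g a = c ∧ g b = d)
    (hcard : ∀ a b : A, ∃ c, c ≠ a ∧ c ≠ b) (hJ : ∀ C ∈ J.constraints, IsPP L (· ∈ C.rel))
    (hne : J.Nontrivial) (hmin : J.IsMinimal m ℓ) (hm : 2 ≤ m) (hℓ : 3 ≤ ℓ) :
    (J.contract (Quotient.mk (hmin.eqSetoid hm hℓ))).Nontrivial := by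
  rintro _ ⟨C, hC, rfl⟩
  obtain ⟨f, hf, h⟩ := exists_forall_ne hA hk hsw hG hcard (hJ C hC) (hne C hC)
    {e | ¬ (hmin.eqSetoid hm hℓ).r e.1 e.2} fun e he => hmin.exists_ne_of_not_eqSetoid hm hℓ hC he
  obtain ⟨f', hf', -⟩ := hmin.exists_contract hm hℓ hC hf fun x y hxy => h (x, y) hxy
  exact ⟨f', hf'⟩

theorem Instance.IsMinimal.isMinimal_contract
    (hA : IsFirstOrderExpansion (canonicalLanguage G k) L A) (hk : 2 ≤ k)
    (hsw : HasBoundedStrictWidth L A)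
    (hG : ∀ a b c d : A, a ≠ b → c ≠ d → ∃ g ∈ G, g a = c ∧ g b = d)
    (hcard : ∀ a b : A, ∃ c, c ≠ a ∧ c ≠ b) (hJ : ∀ C ∈ J.constraints, IsPP L (· ∈ C.rel))
    (hmin : J.IsMinimal k ℓ) (hℓ : k + 1 ≤ ℓ) :
    (J.contract (Quotient.mk (hmin.eqSetoid hk (by omega)))).IsMinimal k ℓ := by
  set s := hmin.eqSetoid hk (by omega) with hs
  constructor
  · intro n h1 h2 t
    obtain ⟨C, hC, h⟩ := hmin.1 n h1 h2 fun i => (t i).out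
    refine ⟨_, ⟨C, hC, rfl⟩, ?_⟩
    rintro _ ⟨i, rfl⟩
    exact ⟨(t i).out, h ⟨i, rfl⟩, (t i).out_eq⟩
  · have key : ∀ n : ℕ, 1 ≤ n → n ≤ k → ∀ t : Fin n → Quotient s,
        ∀ C₁ ∈ J.constraints, ∀ C₂ ∈ J.constraints,
        ∀ (h₁ : ∀ i, t i ∈ (C₁.contract (Quotient.mk s)).scope)
          (h₂ : ∀ i, t i ∈ (C₂.contract (Quotient.mk s)).scope),
        (C₁.contract (Quotient.mk s)).proj (fun i => ⟨t i, h₁ i⟩) ⊆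
          (C₂.contract (Quotient.mk s)).proj (fun i => ⟨t i, h₂ i⟩) := by
      rintro n hn1 hnk t C₁ hC₁ C₂ hC₂ h₁ h₂ _ ⟨f₁, ⟨hf₁, hinj⟩, rfl⟩
      have : Nonempty (Set.range t) := ⟨⟨_, ⟨0, hn1⟩, rfl⟩⟩
      have hcardκ : Nat.card (Set.range t) ≤ k := by
        change (Set.range t).ncard ≤ k
        rw [← Set.image_univ]
        exact (Set.ncard_image_le Set.finite_univ).trans (by simpa [Set.ncard_univ])
      have h₁' : ∀ v : Set.range t, v.1 ∈ Quotient.mk s '' C₁.scope := by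
        rintro ⟨_, i, rfl⟩; exact h₁ i
      have h₂' : ∀ v : Set.range t, v.1 ∈ Quotient.mk s '' C₂.scope := by
        rintro ⟨_, i, rfl⟩; exact h₂ i
      choose u₁ hu₁ huπ₁ using h₁'
      choose u₂ hu₂ huπ₂ using h₂'
      obtain ⟨f₂, hf₂, hff⟩ := hmin.exists_rel_of_equiv hk hℓ hcardκ (t₁ := u₁) (t₂ := u₂)
        (fun v => Quotient.exact ((huπ₁ v).trans (huπ₂ v).symm)) hC₁ hC₂ hu₁ hu₂ hf₁
      let a : Set.range t → A := fun v => f₁ ⟨v.1, by obtain ⟨_, i, rfl⟩ := v; exact h₁ i⟩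
      have ha : a.Injective := fun v v' h => by
        have := hinj h
        exact Subtype.ext (Subtype.mk.inj this)
      have hfa : ∀ v, f₂ ⟨u₂ v, hu₂ v⟩ = a v := by
        intro v
        rw [hff v]
        exact congrArg f₁ (Subtype.ext (huπ₁ v))
      have hO := isPP_orbit hA hcardκ a
      -- The transferred `f₂` may identify inequivalent variables. Requiring only the orbit of `a`
      -- keeps the predicate pp-definable and allows all unwanted equalities to be violated;
      -- applying `g⁻¹` afterwards restores the exact values `a`.
      obtain ⟨f, ⟨hf, g, hg, hfg⟩, hfne⟩ := exists_forall_ne hA hk hsw hG hcard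
        ((hJ C₂ hC₂).and (hO.comp fun v => (⟨u₂ v, hu₂ v⟩ : C₂.scope)))
        ⟨f₂, hf₂, 1, G.one_mem, funext hfa⟩ {e | ¬ s.r e.1 e.2} fun e he => by
          obtain ⟨x, hx, hx', hne⟩ := exists_orbit_and_ne hA hsw hG hcard ha hO (hJ C₂ hC₂)
            (fun v => (⟨u₂ v, hu₂ v⟩ : C₂.scope)) e.1 e.2
            ⟨f₂, hf₂, 1, G.one_mem, funext hfa⟩ (hmin.exists_ne_of_not_eqSetoid hk _ hC₂ he)
          exact ⟨x, ⟨hx, hx'⟩, hne⟩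
      have hf' := ((hJ C₂ hC₂).smul_iff hA (G.inv_mem hg) f).2 hf
      obtain ⟨f', hf', hff'⟩ := hmin.exists_contract hk (by omega) hC₂ hf' fun x y hxy h =>
        hfne (x, y) hxy (g⁻¹.injective h)
      refine ⟨f', hf', funext fun i => ?_⟩
      have e1 := hff' ⟨u₂ ⟨t i, i, rfl⟩, hu₂ _⟩
      have e2 := congrFun hfg ⟨t i, i, rfl⟩
      simp only [Function.comp_apply] at e1 e2
      rw [e2, ← Equiv.Perm.mul_apply, inv_mul_cancel, Equiv.Perm.one_apply] at e1
      refine e1.symm.trans (congrArg f' (Subtype.ext (huπ₂ _)))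
    rintro n hn1 hnk t _ ⟨C₁, hC₁, rfl⟩ _ ⟨C₂, hC₂, rfl⟩ h₁ h₂
    exact (key n hn1 hnk t C₁ hC₁ C₂ hC₂ h₁ h₂).antisymm (key n hn1 hnk t C₂ hC₂ C₁ hC₁ h₂ h₁)

end Reduction

/-! ### Solving, or refuting, the contracted instance. -/

section Reduction

variable {A : Type u} {G : Subgroup (Equiv.Perm A)} {k : ℕ} {L : FirstOrder.Language.{v, w}}
  [L.Structure A]

/-- An orbit of injective tuples, as a constraint. -/
def orbitConstraint {V : Type} (G : Subgroup (Equiv.Perm A)) {k : ℕ} (hk : 0 < k) (t : Fin k ↪ V)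
    (a : Fin k → A) : Constraint V A where
  scope := Set.range t
  nonempty := ⟨t ⟨0, hk⟩, _, rfl⟩
  rel := {f | ∃ g ∈ G, ∀ i, f ⟨t i, i, rfl⟩ = g (a i)}

theorem orbitConstraint_isOf (hA : IsFirstOrderExpansion (canonicalLanguage G k) L A) {V : Type}
    (hk : 0 < k) (t : Fin k ↪ V) (a : Fin k → A) : (orbitConstraint G hk t a).IsOf L := by
  obtain ⟨φ, hφ⟩ := hA.2.1
  let O : (canonicalLanguage G k).Relations k := ⟨Quotient.mk'' a, rfl⟩
  refine ⟨k, Equiv.ofInjective t t.injective, φ.onRelation O, fun f => ?_⟩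
  rw [LHom.map_onRelation]
  change _ ↔ f ∘ _ ∈ O.1.orbit
  rw [MulAction.orbitRel.Quotient.mem_orbit]
  constructor
  · rintro ⟨g, hg, h⟩
    exact Quotient.sound' ⟨⟨g, hg⟩, (funext h).symm⟩
  · intro h
    obtain ⟨g, hg⟩ := Quotient.exact' h
    exact ⟨g, g.2, fun i => (congrFun hg i).symm⟩

/-- If the group has two orbits of injective `k`-tuples, then there are unsatisfiable injective
instances on every set of at least `k` variables. -/
theorem exists_unsatisfiable_isInj (hA : IsFirstOrderExpansion (canonicalLanguage G k) L A)
    {V : Type} (hk : 0 < k) (t : Fin k ↪ V) {a b : Fin k → A} (ha : a.Injective)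
    (hb : b.Injective) (hab : ¬ ∃ g ∈ G, ∀ i, g (a i) = b i) :
    ∃ I : Instance V A, I.IsOf L ∧ I.IsInj ∧ ∀ f, ¬ I.IsSolution f := by
  have hinj : ∀ {a : Fin k → A}, a.Injective → ∀ x y : (orbitConstraint G hk t a).scope, x ≠ y →
      (orbitConstraint G hk t a).proj ![x, y] ⊆ {a : Fin 2 → A | Function.Injective a} := by
    rintro a ha ⟨_, p, rfl⟩ ⟨_, q, rfl⟩ hpq _ ⟨f, ⟨g, -, h⟩, rfl⟩
    have hf : f.Injective := by
      rintro ⟨_, i, rfl⟩ ⟨_, j, rfl⟩ hij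
      have := ha (g.injective ((h i).symm.trans (hij.trans (h j))))
      subst this
      rfl
    refine hf.comp fun i j hij => ?_
    fin_cases i <;> fin_cases j <;> simp_all
  refine ⟨⟨{orbitConstraint G hk t a, orbitConstraint G hk t b}, Set.toFinite _⟩, ?_, ?_, ?_⟩
  · rintro _ (rfl | rfl)
    · exact orbitConstraint_isOf hA hk t a
    · exact orbitConstraint_isOf hA hk t b
  · rintro _ (rfl | rfl)
    · exact hinj ha
    · exact hinj hb
  · intro f hf
    obtain ⟨g, hg, h⟩ := hf _ (.inl rfl)
    obtain ⟨g', hg', h'⟩ := hf _ (.inr rfl)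
    refine hab ⟨g'⁻¹ * g, G.mul_mem (G.inv_mem hg') hg, fun i => ?_⟩
    rw [Equiv.Perm.mul_apply, Equiv.Perm.inv_eq_iff_eq, ← h, ← h']

/-- Minimal instances with few variables have solutions. -/
theorem Instance.IsMinimal.exists_isSolution_of_card_le [Nonempty A] {V : Type} [Finite V]
    {J : Instance V A} {ℓ : ℕ} (hmin : J.IsMinimal k ℓ) (hℓ : k ≤ ℓ) (hne : J.Nontrivial)
    (hV : Nat.card V ≤ k) : ∃ f, J.IsSolution f := by
  rcases isEmpty_or_nonempty V with hV' | hV'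
  · exact ⟨isEmptyElim, fun C _ => isEmptyElim C.nonempty.some⟩
  · obtain ⟨C₀, hC₀, h₀⟩ := hmin.exists_scope (hV.trans hℓ) id
    obtain ⟨f₀, hf₀⟩ := hne C₀ hC₀
    refine ⟨fun x => f₀ ⟨x, h₀ x⟩, fun C hC => ?_⟩
    have : Nonempty C.scope := C.nonempty.to_subtype
    obtain ⟨f, hf, h⟩ := hmin.exists_rel (κ := C.scope)
      ((Nat.card_le_card_of_injective _ Subtype.val_injective).trans hV) (fun x => (x : V)) hC₀ hC
      (fun x => h₀ x) (fun x => x.2) hf₀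
    convert hf using 1
    exact (funext h).symm

/-- If the group is `k`-transitive, then every non-trivial injective instance has a solution. -/
theorem Instance.IsInj.exists_isSolution [Infinite A]
    (hA : IsFirstOrderExpansion (canonicalLanguage G k) L A)
    (htrans : ∀ a b : Fin k → A, a.Injective → b.Injective → ∃ g ∈ G, ∀ i, g (a i) = b i)
    {V : Type} [Finite V] {J : Instance V A} (hJ : ∀ C ∈ J.constraints, IsPP L (· ∈ C.rel))
    (hinj : J.IsInj) (hne : J.Nontrivial) : ∃ f, J.IsSolution f := by
  classical
  -- The tuple may have repetitions, so its entries are first enlarged to exactly `k` distinct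
  -- elements. Consequently all permutations preserve the pp-definable predicates.
  have hσ : ∀ (σ : Equiv.Perm A) (x : Fin k → A), ∃ g ∈ G, ∀ i, g (x i) = σ (x i) := by
    intro σ x
    obtain ⟨s, hs, hcard⟩ := Infinite.exists_superset_card_eq (Finset.univ.image x) k
      (Finset.card_image_le.trans (by simp))
    let e := s.equivFinOfCardEq hcard
    obtain ⟨g, hg, h⟩ := htrans (fun i => e.symm i) (fun i => σ (e.symm i))
      (Subtype.val_injective.comp e.symm.injective)
      (σ.injective.comp (Subtype.val_injective.comp e.symm.injective))
    refine ⟨g, hg, fun i => ?_⟩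
    have hi : x i ∈ s := hs (Finset.mem_image_of_mem x (Finset.mem_univ i))
    simpa using h (e ⟨x i, hi⟩)
  let F : V → A := fun x => Infinite.natEmbedding A (Finite.equivFin V x)
  have hF : F.Injective := fun x y h =>
    (Finite.equivFin V).injective (Fin.val_injective ((Infinite.natEmbedding A).injective h))
  refine ⟨F, fun C hC => ?_⟩
  obtain ⟨f, hf⟩ := hne C hC
  have hfinj : f.Injective := by
    intro x y hxy
    by_contra hne
    have := hinj C hC x y hne ⟨f, hf, rfl⟩
    exact zero_ne_one (this (a₁ := 0) (a₂ := 1) (by simpa using hxy))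
  let e := Finite.equivFin C.scope
  have := Equiv.Perm.isMultiplyPretransitive A (Nat.card C.scope)
  obtain ⟨σ, hσ'⟩ := MulAction.exists_smul_eq (Equiv.Perm A)
    (⟨f ∘ e.symm, hfinj.comp e.symm.injective⟩ : Fin (Nat.card C.scope) ↪ A)
    ⟨fun i => F (e.symm i), hF.comp (Subtype.val_injective.comp e.symm.injective)⟩
  convert ((hJ C hC).map_iff hA (hσ σ) f).2 hf using 1
  funext x
  have h : σ (f (e.symm (e x))) = F (e.symm (e x)) := DFunLike.congr_fun hσ' (e x)
  rw [e.symm_apply_apply] at h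
  exact h.symm

end Reduction

end CSP

/-! ### Assembly of the equivalence. -/

theorem mainTheorem4 {A : Type u} [Nonempty A] (k : ℕ) (hk : 2 ≤ k)
    (G : Subgroup (Equiv.Perm A)) (hG : CSP.Oligomorphic G)
    (hG2 : MulAction.IsMultiplyPretransitive G A 2)
    (hB : CSP.FinitelyBounded (CSP.canonicalLanguage G k) A)
    (L : FirstOrder.Language.{v, w}) [L.Structure A]
    (hA : CSP.IsFirstOrderExpansion (CSP.canonicalLanguage G k) L A)
    (hsw : CSP.HasBoundedStrictWidth L A) :
    CSP.HasRelationalWidth L A k (max (k + 1) (CSP.boundSize (CSP.canonicalLanguage G k) A)) ↔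
      CSP.InjHasRelationalWidth L A k
        (max (k + 1) (CSP.boundSize (CSP.canonicalLanguage G k) A)) := by
  have hℓ := le_max_left (k + 1) (CSP.boundSize (CSP.canonicalLanguage G k) A)
  generalize max (k + 1) (CSP.boundSize (CSP.canonicalLanguage G k) A) = ℓ at hℓ
  have hG' : ∀ a b c d : A, a ≠ b → c ≠ d → ∃ g ∈ G, g a = c ∧ g b = d := by
    intro a b c d hab hcd
    obtain ⟨g, h⟩ := MulAction.is_two_pretransitive_iff.1 hG2 hab hcd
    exact ⟨g, g.2, h⟩
  constructor
  · rintro h V _ J hJ - hmin hne ⟨I, hI, -, hJI⟩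
    exact h V J hJ hmin hne ⟨I, hI, hJI⟩
  rintro h V _ J hJ hmin hne -
  have hJ' : ∀ C ∈ J.constraints, CSP.IsPP L (· ∈ C.rel) := fun C hC =>
    (CSP.Constraint.isOf_ppLanguage_iff.1 (hJ C hC)).1
  by_cases hcard : ∀ a b : A, ∃ c, c ≠ a ∧ c ≠ b
  · have hinf := CSP.infinite_of_hasBoundedStrictWidth hA hk hsw hG' hcard
    let s := hmin.eqSetoid hk (by omega)
    have hC : (J.contract (Quotient.mk s)).IsOf (CSP.ppLanguage L A ℓ) :=
      CSP.Instance.isOf_contract hA hk hG' hcard _ hJ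
    have hCmin : (J.contract (Quotient.mk s)).IsMinimal k ℓ :=
      hmin.isMinimal_contract hA hk hsw hG' hcard hJ' hℓ
    have hCne : (J.contract (Quotient.mk s)).Nontrivial :=
      CSP.Instance.IsMinimal.nontrivial_contract hA hk hsw hG' hcard hJ' hne hmin hk (by omega)
    have hCinj := J.isInj_contract (Quotient.mk s)
    -- Assuming unsatisfiability makes the contracted instance equivalent to any unsatisfiable
    -- injective instance, as required to apply `h`.
    by_contra hsol
    have hCsol : ∀ f, ¬ (J.contract (Quotient.mk s)).IsSolution f := fun f hf =>
      hsol ⟨_, hf.of_contract⟩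
    obtain ⟨f, hf⟩ : ∃ f, (J.contract (Quotient.mk s)).IsSolution f := by
      rcases le_total (Nat.card (Quotient s)) k with hV | hV
      · exact hCmin.exists_isSolution_of_card_le (by omega) hCne hV
      by_cases htrans : ∀ a b : Fin k → A, a.Injective → b.Injective →
          ∃ g ∈ G, ∀ i, g (a i) = b i
      · exact hCinj.exists_isSolution hA htrans
          (fun C h => (CSP.Constraint.isOf_ppLanguage_iff.1 (hC C h)).1) hCne
      · simp only [not_forall] at htrans
        obtain ⟨a, b, ha, hb, hab⟩ := htrans
        obtain ⟨I, hI, hIinj, hIsol⟩ := CSP.exists_unsatisfiable_isInj hA (by omega)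
          ((Fin.castLEEmb hV).trans (Finite.equivFin (Quotient s)).symm.toEmbedding) ha hb hab
        exact h _ _ hC hCinj hCmin hCne
          ⟨I, hI, hIinj, fun f => iff_of_false (hCsol f) (hIsol f)⟩
    exact hCsol f hf
  · push Not at hcard
    obtain ⟨a, b, hab⟩ := hcard
    by_cases hne' : a = b
    · subst hne'
      have hsub : ∀ c, c = a := fun c => by_contra fun h => h (hab c h)
      refine ⟨fun _ => a, fun C hC => ?_⟩
      obtain ⟨f, hf⟩ := hne C hC
      convert hf using 1
      exact funext fun x => (hsub _).symm
    · refine CSP.exists_isSolution_of_two_elements hA hsw hG' ?_ ?_ hJ' hk (by omega) hmin hne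
      · intro x y z hxz hyz
        have h₁ := hab x
        have h₂ := hab y
        have h₃ := hab z
        by_cases hx : x = a
        · by_cases hy : y = a
          · rw [hx, hy]
          · exact absurd ((h₂ hy).trans (h₃ (hx ▸ hxz.symm)).symm) hyz
        · by_cases hy : y = a
          · exact absurd ((h₁ hx).trans (h₃ (hy ▸ hyz.symm)).symm) hxz
          · rw [h₁ hx, h₂ hy]
      · intro x
        by_cases hx : x = a
        · exact ⟨b, hx ▸ hne'⟩
        · exact ⟨a, hx⟩
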